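/- Let $\Omega$ be the set of pairs $\omega=(I,S)$ of continuous functions $I,S:[0,\infty)\to(0,\infty)$ with $I(0)=1$, with the $\sigma$-algebra generated by the evaluations $\omega\mapsto\omega(t)=(I(t),S(t))$. A *stopping time* is a measurable $\tau:\Omega\to[0,\infty]$ such that $\omega|_{[0,\tau(\omega)]}=\omega'|_{[0,\tau(\omega)]}$ implies $\tau(\omega)=\tau(\omega')$; a function $h$ on $\Omega$ is *$\tau$-measurable* if it is measurable and the same premise implies $h(\omega)=h(\omega')$. A *simple capital process* is a process $$\mathcal K_t(\omega)=c+\sum_{n\ge1}h_n(\omega)\cdot\bigl(\omega(\tau_{n+1}\wedge t)-\omega(\tau_n\wedge t)\bigr),$$ where $c\in\mathbb R$, $\tau_1\le\tau_2\le\cdots$ are stopping times tending to $\infty$ pointwise, and each $h_n:\Omega\to\mathbb R^2$ is bounded and $\tau_n$-measurable. The *test supermartingales* form the smallest class of processes $[0,\infty)\times\Omega\to[-\infty,\infty]$ that contains all nonnegative simple capital processes and is closed under $(X^k)_k\mapsto\liminf_{k\to\infty}X^k$ (pointwise). The initial value $X_0$ of a test supermartingale $X$ is a constant. For $E\subseteq\Omega$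 the *upper $I$-probability* is $$\overline{\mathbb P}^I(E)=\inf\Bigl\{X_0 : \liminf_{t\to\infty}X_t(\omega)/I_t(\omega)\ge\mathbf 1_E(\omega)\text{ for all }\omega\in\Omega\Bigr\},$$ with $X$ ranging over the test supermartingales, and the *lower $I$-probability* is $\underline{\mathbb P}^I(E)=1-\overline{\mathbb P}^I(\Omega\setminus E)$. Let $T^n_0=0$ and $T^n_k=\inf\{t>T^n_{k-1} : |I(t)-I(T^n_{k-1})|=2^{-n}\}$ for $k\ge 1$ (with $\inf\emptyset=\infty$), put $$m^{n}_{k}(t)=\frac{I(T^n_k\wedge t)-I(T^n_{k-1}\wedge t)}{I(T^n_{k-1}\wedge t)},$$ and let $$\Sigma^I_t=\lim_{n\to\infty}\sum_{k\ge1}m^n_k(t)^2,\qquad \mathrm M^I_t=\lim_{n\to\infty}\sum_{k\ge1}m^n_k(t),$$ where "$\Sigma^I$ and $\mathrm M^I$ exist" means that both limits exist uniformly in $t$ on every compact interval. For $T>0$ let $\tau_T=\inf\{t : \Sigma^I_t\ge T\}\in[0,\infty]$. **Corollary.** Let $\delta>0$ and $T>0$, and let $r=\sqrt{2T\ln(2/\delta)}$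 (read as $0$ if $\delta>2$). Let $E_1$ be the event that $\Sigma^I$ and $\mathrm M^I$ exist and, if $\tau_T<\infty$, then $|\mathrm M^I_{\tau_T}-T|<r$. Let $E_2$ be the event that $\Sigma^I$ and $\mathrm M^I$ exist and, if $\tau_T<\infty$, then $|\ln I_{\tau_T}-T/2|<r$. Then $$\underline{\mathbb P}^I(E_1)\ge1-\delta\qquad\text{and}\qquad\underline{\mathbb P}^I(E_2)\ge1-\delta,$$ and these two assertions are equivalent, since $E_1=E_2$. -/

import Mathlib

open Set Filter Topology
open scoped NNReal ENNReal

noncomputable section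

namespace EquityPremium

/-- A point `ω = (I, S)` of the sample space: a pair of positive continuous price paths
on `[0, ∞)`, with `I 0 = 1`. -/
structure PricePath where
  I : ℝ≥0 → ℝ
  S : ℝ≥0 → ℝ
  continuous_I : Continuous I
  continuous_S : Continuous S
  pos_I : ∀ t, 0 < I t
  pos_S : ∀ t, 0 < S t
  I_zero : I 0 = 1

/-- The σ-algebra generated by the evaluations `ω ↦ ω(t) = (I t, S t)`. -/
instance : MeasurableSpace PricePath :=
  ⨆ t : ℝ≥0, MeasurableSpace.comap (fun ω : PricePath => (ω.I t, ω.S t)) inferInstance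

/-- `ω` and `ω'` have the same restriction to `[0, a]` (to `[0, ∞)` if `a = ∞`). -/
def AgreeUpTo (a : ℝ≥0∞) (ω ω' : PricePath) : Prop :=
  ∀ s : ℝ≥0, (s : ℝ≥0∞) ≤ a → ω.I s = ω'.I s ∧ ω.S s = ω'.S s

/-- Stopping times with values in `[0, ∞]`. -/
structure IsStopTime (τ : PricePath → ℝ≥0∞) : Prop where
  measurable : Measurable τ
  determined : ∀ ω ω', AgreeUpTo (τ ω) ω ω' → τ ω = τ ω'

/-- The time `a ∧ t`, for `a ∈ [0, ∞]` and finite `t`. -/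
def capTime (a : ℝ≥0∞) (t : ℝ≥0) : ℝ≥0 := (min a (t : ℝ≥0∞)).toNNReal

/-- Simple trading strategies. `hold n ω` lists the numbers of units of `I` and of `S`
held between the times `time n ω` and `time (n + 1) ω`. -/
structure SimpleStrategy where
  time : ℕ → PricePath → ℝ≥0∞
  hold : ℕ → PricePath → ℝ × ℝ
  time_isStopTime : ∀ n, IsStopTime (time n)
  time_le_succ : ∀ n ω, time n ω ≤ time (n + 1) ω
  time_tendsto : ∀ ω, Tendsto (fun n => time n ω) atTop (𝓝 ∞)
  hold_measurable : ∀ n, Measurable (hold n)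
  hold_bounded : ∀ n, ∃ C : ℝ, ∀ ω, ‖hold n ω‖ ≤ C
  hold_determined : ∀ n ω ω', AgreeUpTo (time n ω) ω ω' → hold n ω = hold n ω'

/-- The simple capital process of the strategy `G` with initial capital `c`.
For each `t` and `ω` only finitely many terms of the sum are nonzero. -/
def simpleCapital (G : SimpleStrategy) (c : ℝ) (t : ℝ≥0) (ω : PricePath) : ℝ :=
  c + ∑' n, ((G.hold n ω).1 *
        (ω.I (capTime (G.time (n + 1) ω) t) - ω.I (capTime (G.time n ω) t)) +
      (G.hold n ω).2 *
        (ω.S (capTime (G.time (n + 1) ω) t) - ω.S (capTime (G.time n ω) t)))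

/-- Test supermartingales: the smallest class of processes that contains all nonnegative
simple capital processes and is closed under pointwise `liminf` of sequences. -/
inductive IsTestSupermartingale : (ℝ≥0 → PricePath → EReal) → Prop
  | simple (G : SimpleStrategy) (c : ℝ) (h : ∀ t ω, 0 ≤ simpleCapital G c t ω) :
      IsTestSupermartingale (fun t ω => (simpleCapital G c t ω : EReal))
  | liminf (X : ℕ → ℝ≥0 → PricePath → EReal) (h : ∀ k, IsTestSupermartingale (X k)) :
      IsTestSupermartingale (fun t ω => Filter.liminf (fun k => X k t ω) atTop)

/-- The upper `I`-probability of an event: the infimum of the (constant) initial values of the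
test supermartingales `X` with `liminf_{t → ∞} X_t / I_t ≥ 1_E` everywhere. -/
def upperProbI (E : Set PricePath) : EReal :=
  sInf {x : EReal | ∃ X : ℝ≥0 → PricePath → EReal, IsTestSupermartingale X ∧
    (∀ ω, X 0 ω = x) ∧
    ∀ ω, E.indicator (fun _ => (1 : EReal)) ω ≤
      Filter.liminf (fun t : ℝ≥0 => X t ω / (ω.I t : EReal)) atTop}

/-- The lower `I`-probability of an event. -/
def lowerProbI (E : Set PricePath) : EReal := 1 - upperProbI Eᶜ

/-- The partition times `T^n_k`: `T^n_0 = 0`, and `T^n_{k+1}` is the first time after `T^n_k` at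
which `I` has moved by `2^{-n}` from its value at `T^n_k` (`∞` if there is none). -/
def partTime (n : ℕ) (ω : PricePath) : ℕ → ℝ≥0∞
  | 0 => 0
  | k + 1 => sInf {u : ℝ≥0∞ | ∃ t : ℝ≥0, u = t ∧ partTime n ω k < t ∧
      |ω.I t - ω.I (partTime n ω k).toNNReal| = (2 : ℝ)⁻¹ ^ n}

/-- The relative increment of `I` over `[T^n_k ∧ t, T^n_{k+1} ∧ t]`. -/
def relIncr (n : ℕ) (ω : PricePath) (t : ℝ≥0) (k : ℕ) : ℝ :=
  (ω.I (capTime (partTime n ω (k + 1)) t) - ω.I (capTime (partTime n ω k) t)) /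
    ω.I (capTime (partTime n ω k) t)

/-- `Σ^{I,n}_t`. Only finitely many terms are nonzero. -/
def relQVApprox (n : ℕ) (ω : PricePath) (t : ℝ≥0) : ℝ := ∑' k, relIncr n ω t k ^ 2

/-- `M^{I,n}_t`. Only finitely many terms are nonzero. -/
def growthApprox (n : ℕ) (ω : PricePath) (t : ℝ≥0) : ℝ := ∑' k, relIncr n ω t k

/-- The relative quadratic variation `Σ^I_t = lim_n Σ^{I,n}_t` (arbitrary if there is no limit). -/
def relQV (ω : PricePath) (t : ℝ≥0) : ℝ := limUnder atTop (fun n => relQVApprox n ω t)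

/-- The cumulative relative growth `M^I_t = lim_n M^{I,n}_t` (arbitrary if there is no limit). -/
def growth (ω : PricePath) (t : ℝ≥0) : ℝ := limUnder atTop (fun n => growthApprox n ω t)

/-- On the path `ω` the limits defining `Σ^I` and `M^I` exist, uniformly on each interval
`[0, t]`. -/
def LimitsExist (ω : PricePath) : Prop :=
  ∀ t : ℝ≥0, TendstoUniformlyOn (fun n => relQVApprox n ω) (relQV ω) atTop (Icc 0 t) ∧
    TendstoUniformlyOn (fun n => growthApprox n ω) (growth ω) atTop (Icc 0 t)

/-- `τ_T = inf {t | Σ^I_t ≥ T}`, which is `∞` if there is no such `t`. -/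
def hitTime (T : ℝ) (ω : PricePath) : ℝ≥0∞ :=
  sInf {u : ℝ≥0∞ | ∃ t : ℝ≥0, u = t ∧ T ≤ relQV ω t}

/-- The event that `Σ^I` and `M^I` exist and, if `τ_T < ∞`, that `|M^I_{τ_T} - T| < r`. -/
def growthEvent (T r : ℝ) : Set PricePath :=
  {ω | LimitsExist ω ∧ (hitTime T ω < ∞ → |growth ω (hitTime T ω).toNNReal - T| < r)}

/-- The event that `Σ^I` and `M^I` exist and, if `τ_T < ∞`, that `|ln I_{τ_T} - T/2| < r`. -/
def logEvent (T r : ℝ) : Set PricePath :=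
  {ω | LimitsExist ω ∧
    (hitTime T ω < ∞ → |Real.log (ω.I (hitTime T ω).toNNReal) - T / 2| < r)}

end EquityPremium

end

/-!
The set `LimitsExist` is where the growth approximations `M^n` converge uniformly on compact
intervals, because along the `n`-th partition `ln I = M^n - Σ^n / 2 + O (2^{-n} Σ^n)`
(`abs_log_I_sub_le`), so that convergence of `M^n` forces convergence of `Σ^n`
(`tendstoUniformlyOn_relQV`). In the limit, `ln I = M - Σ / 2` (`LimitsExist.log_I_eq`), and as `Σ`
is continuous it equals `T` at the time `τ_T`; hence the two events coincide
(`growthEvent_eq_logEvent`).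

For the bound on the upper probability, capital `δ + ε` is traded at the times of the `N`-th
partition, with `N → ∞`. All holdings are functions of the prices observed at these times
(`IsTradingRule`), so that the capital is a finite sum along a real sequence with steps of size at
most `2^{-N}`, and the strategies can be added without merging their stopping times.

* The part `ε` makes the capital infinite where the limits do not exist. As the partitions are
  nested (`partTime_succ_le_of_cell`), `M^{n+1} - M^n` is an integral with respect to `I` along each
  finer grid, with an integrand of order `n² 2^{-n}` while the price stays in
  `[1 / (n + 1), n + 1]`.
  Stopped when the price leaves this zone or the integral reaches `(3 / 4)^n`, its square is
  dominated by the capital of a strategy (`gapInt_sq_le`) whose cost, divided by `(3 / 4)^{2n}`, is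
  summable in `n` (`summable_gapCost`). If `M^n` does not converge, infinitely many of these
  strategies reach a scaled capital of at least `1`, so that their total capital is infinite
  (`eventually_le_capital_of_not_limitsExist`).
* The part `δ` is split equally between the two portfolios that keep the fractions `1 ± θ`,
  `θ = r / T`, of their capital in `I` until the squared returns add up to `T - η`, and are invested
  in `I` afterwards. With leverage `l` the logarithm of the capital in units of `I` is then about
  `(l - 1) ln I + (l - l²) T / 2` (`log_portfolio_ge`), which for `l = 1 ± θ` equals
  `± θ (ln I - T / 2) - θ² T / 2`. If `|ln I - T / 2| ≥ r` at the time `τ_T`, this is at least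
  `r² / (2 T) ≥ ln (2 / δ)` for one of the signs, so that the capital is worth at least one unit of
  `I` from `τ_T` on. The margin `η` is sent to `0` after `N → ∞` (`eventually_le_portfolio`).
-/

namespace EquityPremium

/-! ### Truncated times -/

theorem coe_capTime (a : ℝ≥0∞) (t : ℝ≥0) : (capTime a t : ℝ≥0∞) = min a t :=
  ENNReal.coe_toNNReal (ne_top_of_le_ne_top ENNReal.coe_ne_top (min_le_right _ _))

theorem capTime_le (a : ℝ≥0∞) (t : ℝ≥0) : capTime a t ≤ t := by
  rw [← ENNReal.coe_le_coe, coe_capTime]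
  exact min_le_right _ _

theorem capTime_of_ge {a : ℝ≥0∞} {t : ℝ≥0} (h : (t : ℝ≥0∞) ≤ a) : capTime a t = t := by
  rw [← ENNReal.coe_inj, coe_capTime, min_eq_right h]

theorem capTime_of_le {a : ℝ≥0∞} {t : ℝ≥0} (h : a ≤ t) : capTime a t = a.toNNReal := by
  rw [capTime, min_eq_left h]

@[simp] theorem capTime_zero_right (a : ℝ≥0∞) : capTime a 0 = 0 := by simp [capTime]

@[simp] theorem capTime_zero_left (t : ℝ≥0) : capTime 0 t = 0 := by simp [capTime]

theorem continuous_capTime (a : ℝ≥0∞) : Continuous (capTime a) := by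
  rw [ENNReal.isOpenEmbedding_coe.isEmbedding.continuous_iff]
  have : ((↑) : ℝ≥0 → ℝ≥0∞) ∘ capTime a = fun t : ℝ≥0 => min a (t : ℝ≥0∞) :=
    funext fun t => coe_capTime a t
  rw [this]
  exact continuous_const.min ENNReal.continuous_coe

theorem measurable_capTime : Measurable fun p : ℝ≥0∞ × ℝ≥0 => capTime p.1 p.2 :=
  (measurable_fst.min (measurable_snd.coe_nnreal_ennreal)).ennreal_toNNReal

/-! ### The partition times -/

theorem partTime_succ_of_eq_top {n : ℕ} {ω : PricePath} {k : ℕ} (h : partTime n ω k = ∞) :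
    partTime n ω (k + 1) = ∞ := by
  simp [partTime, h]

/-- Either the path never moves by `2^{-n}` after `T^n_k`, or `T^n_{k+1}` is the least time at
which it has done so; the infimum is attained because the path is continuous. -/
theorem partTime_succ_cases {n : ℕ} {ω : PricePath} {k : ℕ} {a : ℝ≥0}
    (h : partTime n ω k = a) :
    (partTime n ω (k + 1) = ∞ ∧ ∀ t, a < t → |ω.I t - ω.I a| ≠ (2 : ℝ)⁻¹ ^ n) ∨
      ∃ b : ℝ≥0, partTime n ω (k + 1) = b ∧ a < b ∧ |ω.I b - ω.I a| = (2 : ℝ)⁻¹ ^ n ∧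
        ∀ t, a < t → t < b → |ω.I t - ω.I a| ≠ (2 : ℝ)⁻¹ ^ n := by
  set B : Set ℝ≥0 := {t | a ≤ t ∧ |ω.I t - ω.I a| = (2 : ℝ)⁻¹ ^ n} with hB
  have hBa : ∀ t ∈ B, a < t := by
    rintro t ⟨h1, h2⟩
    refine lt_of_le_of_ne h1 ?_
    rintro rfl
    have : (0 : ℝ) < (2 : ℝ)⁻¹ ^ n := by positivity
    rw [sub_self, abs_zero] at h2
    linarith
  have hBc : IsClosed B :=
    isClosed_Ici.inter (isClosed_eq ((ω.continuous_I.sub continuous_const).abs) continuous_const)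
  have hset : partTime n ω (k + 1) = sInf ((↑) '' B : Set ℝ≥0∞) := by
    rw [partTime, h]
    congr 1
    ext u
    constructor
    · rintro ⟨t, rfl, h1, h2⟩
      exact ⟨t, ⟨(ENNReal.coe_lt_coe.1 h1).le, by simpa using h2⟩, rfl⟩
    · rintro ⟨t, ht, rfl⟩
      exact ⟨t, rfl, ENNReal.coe_lt_coe.2 (hBa t ht), by simpa using ht.2⟩
  rcases B.eq_empty_or_nonempty with he | hne
  · left
    refine ⟨by rw [hset, he]; simp, fun t ht h2 => ?_⟩
    have : t ∈ B := ⟨ht.le, h2⟩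
    simp [he] at this
  · right
    have hmem : sInf B ∈ B := hBc.csInf_mem hne (OrderBot.bddBelow _)
    refine ⟨sInf B, ?_, hBa _ hmem, hmem.2, fun t h1 h2 h3 => ?_⟩
    · rw [hset]
      refine IsLeast.csInf_eq ⟨mem_image_of_mem _ hmem, ?_⟩
      rintro _ ⟨t, ht, rfl⟩
      exact ENNReal.coe_le_coe.2 (csInf_le (OrderBot.bddBelow _) ht)
    · exact absurd (csInf_le (OrderBot.bddBelow _) (show t ∈ B from ⟨h1.le, h3⟩)) (not_le.2 h2)

theorem partTime_lt_succ {n : ℕ} {ω : PricePath} {k : ℕ} (h : partTime n ω k ≠ ∞) :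
    partTime n ω k < partTime n ω (k + 1) := by
  lift partTime n ω k to ℝ≥0 using h with a ha
  rcases partTime_succ_cases ha.symm with h1 | ⟨b, h1, h2, _⟩
  · rw [h1.1]; exact ENNReal.coe_lt_top
  · rw [h1]; exact ENNReal.coe_lt_coe.2 h2

theorem partTime_le_succ (n : ℕ) (ω : PricePath) (k : ℕ) :
    partTime n ω k ≤ partTime n ω (k + 1) := by
  by_cases h : partTime n ω k = ∞
  · rw [h, partTime_succ_of_eq_top h]
  · exact (partTime_lt_succ h).le

theorem partTime_mono (n : ℕ) (ω : PricePath) : Monotone (partTime n ω) :=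
  monotone_nat_of_le_succ (partTime_le_succ n ω)

theorem abs_I_partTime_succ {n : ℕ} {ω : PricePath} {k : ℕ} (h : partTime n ω (k + 1) ≠ ∞) :
    |ω.I (partTime n ω (k + 1)).toNNReal - ω.I (partTime n ω k).toNNReal| = (2 : ℝ)⁻¹ ^ n := by
  have h' : partTime n ω k ≠ ∞ := fun e => h (partTime_succ_of_eq_top e)
  generalize ha : partTime n ω k = p at h'
  lift p to ℝ≥0 using h' with a
  rcases partTime_succ_cases ha with h1 | ⟨b, h1, h2, h3, -⟩
  · exact absurd h1.1 h
  · rw [h1]; simpa using h3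

/-- Strictly before `T^n_{k+1}` the path stays closer than `2^{-n}` to its value at `T^n_k`. -/
theorem abs_I_sub_lt {n : ℕ} {ω : PricePath} {k : ℕ} {s : ℝ≥0} (h1 : partTime n ω k ≤ s)
    (h2 : (s : ℝ≥0∞) < partTime n ω (k + 1)) :
    |ω.I s - ω.I (partTime n ω k).toNNReal| < (2 : ℝ)⁻¹ ^ n := by
  have h' : partTime n ω k ≠ ∞ := ne_top_of_le_ne_top ENNReal.coe_ne_top h1
  generalize ha : partTime n ω k = p at h' h1
  lift p to ℝ≥0 using h' with a
  rw [ENNReal.toNNReal_coe]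
  have has : a ≤ s := ENNReal.coe_le_coe.1 h1
  by_contra! hge
  have hc : ContinuousOn (fun t => |ω.I t - ω.I a|) (Icc a s) :=
    ((ω.continuous_I.sub continuous_const).abs).continuousOn
  obtain ⟨t, ⟨ht1, ht2⟩, ht3⟩ := intermediate_value_Icc has hc
    (show (2 : ℝ)⁻¹ ^ n ∈ Icc _ _ from ⟨by simp, hge⟩)
  have hat : a < t := by
    refine lt_of_le_of_ne ht1 ?_
    rintro rfl
    have : (0 : ℝ) < (2 : ℝ)⁻¹ ^ n := by positivity
    simp only [sub_self, abs_zero] at ht3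
    linarith
  rcases partTime_succ_cases ha with h1 | ⟨b, h1, h2', h3, h4⟩
  · exact h1.2 t hat ht3
  · rw [h1] at h2
    exact h4 t hat (ht2.trans_lt (ENNReal.coe_lt_coe.1 h2)) ht3

theorem abs_I_sub_le {n : ℕ} {ω : PricePath} {k : ℕ} {s : ℝ≥0} (h1 : partTime n ω k ≤ s)
    (h2 : (s : ℝ≥0∞) ≤ partTime n ω (k + 1)) :
    |ω.I s - ω.I (partTime n ω k).toNNReal| ≤ (2 : ℝ)⁻¹ ^ n := by
  rcases h2.lt_or_eq with h | h
  · exact (abs_I_sub_lt h1 h).le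
  · have := abs_I_partTime_succ (n := n) (ω := ω) (k := k) (by rw [← h]; exact ENNReal.coe_ne_top)
    rw [← h] at this
    simpa using this.le

/-- By continuity the path cannot move by `2^{-n}` infinitely often in finite time. -/
theorem tendsto_partTime (n : ℕ) (ω : PricePath) :
    Tendsto (fun k => partTime n ω k) atTop (𝓝 ∞) := by
  have hlim := tendsto_atTop_iSup (partTime_mono n ω)
  by_cases hs : ⨆ k, partTime n ω k = ∞
  · rwa [hs] at hlim
  exfalso
  have hfin : ∀ k, partTime n ω k ≠ ∞ := fun k =>
    ne_top_of_le_ne_top hs (le_iSup (partTime n ω) k)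
  have h1 := (ENNReal.tendsto_toNNReal hs).comp hlim
  have h2 := (ω.continuous_I.tendsto _).comp h1
  have h3 := ((h2.comp (tendsto_add_atTop_nat 1)).sub h2).abs
  have h4 : Tendsto (fun _ : ℕ => (2 : ℝ)⁻¹ ^ n) atTop (𝓝 0) := by
    have := h3.congr fun k => abs_I_partTime_succ (hfin (k + 1))
    simpa only [sub_self, abs_zero] using this
  have h5 := tendsto_nhds_unique h4 tendsto_const_nhds
  have : (0 : ℝ) < (2 : ℝ)⁻¹ ^ n := by positivity
  exact this.ne h5

theorem exists_le_partTime (n : ℕ) (ω : PricePath) (t : ℝ≥0) :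
    ∃ k, (t : ℝ≥0∞) ≤ partTime n ω k :=
  (((tendsto_partTime n ω).eventually (lt_mem_nhds ENNReal.coe_lt_top)).exists).imp
    fun _ h => h.le

/-- Each finite time lies in exactly one cell of the partition. -/
theorem exists_mem_cell (n : ℕ) (ω : PricePath) (t : ℝ≥0) :
    ∃ k, partTime n ω k ≤ t ∧ (t : ℝ≥0∞) < partTime n ω (k + 1) := by
  classical
  have hex : ∃ k, (t : ℝ≥0∞) < partTime n ω k :=
    ((tendsto_partTime n ω).eventually (lt_mem_nhds ENNReal.coe_lt_top)).exists
  have hne : Nat.find hex ≠ 0 := by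
    intro h
    have := Nat.find_spec hex
    rw [h] at this
    simp [partTime] at this
  obtain ⟨k, hk⟩ := Nat.exists_eq_succ_of_ne_zero hne
  refine ⟨k, not_lt.1 (Nat.find_min hex (by omega)), ?_⟩
  have := Nat.find_spec hex
  rwa [hk] at this

/-- The values of the path at the partition times lie on the lattice `2^{-n} ℤ`. -/
theorem exists_int_I_partTime {n : ℕ} {ω : PricePath} {k : ℕ} (h : partTime n ω k ≠ ∞) :
    ∃ z : ℤ, ω.I (partTime n ω k).toNNReal = z * (2 : ℝ)⁻¹ ^ n := by
  induction k with
  | zero =>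
    refine ⟨2 ^ n, ?_⟩
    simp [partTime, ω.I_zero]
  | succ k ih =>
    obtain ⟨z, hz⟩ := ih fun e => h (partTime_succ_of_eq_top e)
    have := abs_I_partTime_succ h
    rcases eq_or_eq_neg_of_abs_eq this with h1 | h1
    · exact ⟨z + 1, by push_cast; linarith⟩
    · exact ⟨z - 1, by push_cast; linarith⟩

/-! ### The partition times are stopping times -/

/-- Before `T^n_k` the increment on the right vanishes, so that no lower bound on `u` is needed. -/
theorem partTime_succ_le_iff (n : ℕ) (ω : PricePath) (k : ℕ) (s : ℝ≥0) :
    partTime n ω (k + 1) ≤ s ↔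
      ∃ u ≤ s, (2 : ℝ)⁻¹ ^ n ≤ |ω.I u - ω.I (capTime (partTime n ω k) u)| := by
  constructor
  · intro h
    have hne : partTime n ω (k + 1) ≠ ∞ := ne_top_of_le_ne_top ENNReal.coe_ne_top h
    refine ⟨(partTime n ω (k + 1)).toNNReal, ?_, ?_⟩
    · exact by rwa [← ENNReal.coe_le_coe, ENNReal.coe_toNNReal hne]
    · rw [capTime_of_le, abs_I_partTime_succ hne]
      rw [ENNReal.coe_toNNReal hne]
      exact partTime_le_succ n ω k
  · rintro ⟨u, hus, hu⟩
    have hpos : (0 : ℝ) < (2 : ℝ)⁻¹ ^ n := by positivity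
    by_contra! hlt
    rcases le_total (partTime n ω k) u with h | h
    · rw [capTime_of_le h] at hu
      exact absurd (abs_I_sub_lt h ((ENNReal.coe_le_coe.2 hus).trans_lt hlt)) (not_lt.2 hu)
    · rw [capTime_of_ge h] at hu
      rw [sub_self, abs_zero] at hu
      linarith

theorem measurable_I (t : ℝ≥0) : Measurable fun ω : PricePath => ω.I t :=
  measurable_fst.comp (Measurable.of_comap_le (le_iSup (fun t : ℝ≥0 =>
    MeasurableSpace.comap (fun ω : PricePath => (ω.I t, ω.S t)) inferInstance) t))

theorem measurable_I_uncurry : Measurable fun p : ℝ≥0 × PricePath => p.2.I p.1 :=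
  MeasureTheory.measurable_uncurry_of_continuous_of_measurable (u := fun t (ω : PricePath) => ω.I t)
    (fun ω => ω.continuous_I) measurable_I

theorem _root_.Measurable.pricePath_I {f : PricePath → ℝ≥0} (hf : Measurable f) :
    Measurable fun ω : PricePath => ω.I (f ω) :=
  measurable_I_uncurry.comp (hf.prodMk measurable_id)

theorem measurable_partTime (n k : ℕ) : Measurable fun ω => partTime n ω k := by
  induction k with
  | zero => exact measurable_const
  | succ k ih =>
    refine measurable_of_Iic fun a => ?_
    induction a with
    | top => simp
    | coe s =>
      obtain ⟨D, hDc, hDd⟩ := TopologicalSpace.exists_countable_dense ℝ≥0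
      -- A continuous function reaches a level on `[0, s]` if and only if it comes arbitrarily
      -- close to it on the countable set `{min d s | d ∈ D}`.
      have key : (fun ω => partTime n ω (k + 1)) ⁻¹' Iic (s : ℝ≥0∞) =
          ⋂ m : ℕ, ⋃ d ∈ D, {ω | (2 : ℝ)⁻¹ ^ n - 1 / ((m : ℝ) + 1) <
            |ω.I (min d s) - ω.I (capTime (partTime n ω k) (min d s))|} := by
        ext ω
        have hc : Continuous fun u => |ω.I u - ω.I (capTime (partTime n ω k) u)| :=
          (ω.continuous_I.sub (ω.continuous_I.comp (continuous_capTime _))).abs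
        simp only [mem_preimage, mem_Iic, partTime_succ_le_iff, mem_iInter, mem_iUnion,
          mem_ofPred_eq, exists_prop]
        constructor
        · rintro ⟨u, hus, hu⟩ m
          have hopen : IsOpen {d : ℝ≥0 | (2 : ℝ)⁻¹ ^ n - 1 / ((m : ℝ) + 1) <
              |ω.I (min d s) - ω.I (capTime (partTime n ω k) (min d s))|} :=
            isOpen_lt continuous_const (hc.comp (continuous_id.min continuous_const))
          obtain ⟨d, hd, hdD⟩ := hDd.inter_open_nonempty _ hopen ⟨u, by
            have : (0 : ℝ) < 1 / ((m : ℝ) + 1) := by positivity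
            simp only [mem_ofPred_eq, min_eq_left hus]
            linarith⟩
          exact ⟨d, hdD, hd⟩
        · intro h
          obtain ⟨u, hu, hmax⟩ := (isCompact_Icc (a := (0 : ℝ≥0)) (b := s)).exists_isMaxOn
            ⟨0, by simp⟩ hc.continuousOn
          refine ⟨u, hu.2, le_of_forall_pos_lt_add fun ε hε => ?_⟩
          obtain ⟨m, hm⟩ := exists_nat_one_div_lt hε
          obtain ⟨d, -, hd⟩ := h m
          have := hmax (show min d s ∈ Icc 0 s from ⟨by simp, min_le_right _ _⟩)
          simp only [mem_ofPred_eq] at this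
          linarith
      rw [key]
      refine MeasurableSet.iInter fun m => MeasurableSet.biUnion hDc fun d _ => ?_
      refine measurableSet_lt measurable_const (Measurable.abs ?_)
      exact (measurable_I _).sub
        (measurable_capTime.comp (ih.prodMk measurable_const)).pricePath_I

theorem AgreeUpTo.mono {a b : ℝ≥0∞} {ω ω' : PricePath} (h : AgreeUpTo b ω ω') (hab : a ≤ b) :
    AgreeUpTo a ω ω' := fun s hs => h s (hs.trans hab)

theorem partTime_determined (n k : ℕ) {ω ω' : PricePath}
    (h : AgreeUpTo (partTime n ω k) ω ω') : partTime n ω k = partTime n ω' k := by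
  induction k with
  | zero => rfl
  | succ k ih =>
    have hk := ih (h.mono (partTime_le_succ n ω k))
    have key : ∀ s : ℝ≥0, (s : ℝ≥0∞) ≤ partTime n ω (k + 1) →
        (partTime n ω (k + 1) ≤ s ↔ partTime n ω' (k + 1) ≤ s) := by
      intro s hs
      rw [partTime_succ_le_iff, partTime_succ_le_iff, ← hk]
      refine exists_congr fun u => and_congr_right fun hu => ?_
      have hu' : (u : ℝ≥0∞) ≤ partTime n ω (k + 1) := (ENNReal.coe_le_coe.2 hu).trans hs
      rw [(h u hu').1, (h (capTime (partTime n ω k) u)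
        ((ENNReal.coe_le_coe.2 (capTime_le _ _)).trans hu')).1]
    refine le_antisymm ?_ ?_
    · by_contra! hlt
      have hne : partTime n ω' (k + 1) ≠ ∞ := hlt.ne_top
      have := (key (partTime n ω' (k + 1)).toNNReal
        (by rw [ENNReal.coe_toNNReal hne]; exact hlt.le)).2 (by rw [ENNReal.coe_toNNReal hne])
      rw [ENNReal.coe_toNNReal hne] at this
      exact absurd hlt (not_lt.2 this)
    · by_cases hne : partTime n ω (k + 1) = ∞
      · rw [hne]; exact le_top
      · have := (key (partTime n ω (k + 1)).toNNReal
          (by rw [ENNReal.coe_toNNReal hne])).1 (by rw [ENNReal.coe_toNNReal hne])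
        rwa [ENNReal.coe_toNNReal hne] at this

theorem isStopTime_partTime (n k : ℕ) : IsStopTime fun ω => partTime n ω k :=
  ⟨measurable_partTime n k, fun _ _ h => partTime_determined n k h⟩

/-! ### Trading rules on a grid -/

/-- The values `I (T^N_k ∧ t)`, `k = 0, 1, …`, of the path at the partition times truncated
at `t`. -/
noncomputable def gridValues (N : ℕ) (ω : PricePath) (t : ℝ≥0) (k : ℕ) : ℝ :=
  ω.I (capTime (partTime N ω k) t)

/-- The properties of the sequences `gridValues N ω t` on which the estimates rely. -/
structure IsGridPath (N : ℕ) (y : ℕ → ℝ) : Prop where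
  zero : y 0 = 1
  pos : ∀ k, 0 < y k
  step : ∀ k, |y (k + 1) - y k| ≤ (2 : ℝ)⁻¹ ^ N

/-- A trading rule for the grid `N`: `F k y` is the number of units of `I` to hold from the `k`-th
grid time on, when `y` lists the prices of `I` at the grid times. -/
structure IsTradingRule (N : ℕ) (F : ℕ → (ℕ → ℝ) → ℝ) : Prop where
  measurable : ∀ k, Measurable (F k)
  adapted : ∀ k y y', (∀ j ≤ k, y j = y' j) → F k y = F k y'
  bounded : ∀ k, ∃ C, ∀ y, IsGridPath N y → |F k y| ≤ C

/-- The gain of the rule `F` over the first `K` periods. -/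
def gain (F : ℕ → (ℕ → ℝ) → ℝ) (y : ℕ → ℝ) (K : ℕ) : ℝ :=
  ∑ j ∈ Finset.range K, F j y * (y (j + 1) - y j)

theorem gain_zero (F : ℕ → (ℕ → ℝ) → ℝ) (y : ℕ → ℝ) : gain F y 0 = 0 := by simp [gain]

theorem gain_succ (F : ℕ → (ℕ → ℝ) → ℝ) (y : ℕ → ℝ) (K : ℕ) :
    gain F y (K + 1) = gain F y K + F K y * (y (K + 1) - y K) := by
  simp [gain, Finset.sum_range_succ]

theorem gridValues_of_ge {N : ℕ} {ω : PricePath} {t : ℝ≥0} {k : ℕ}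
    (h : (t : ℝ≥0∞) ≤ partTime N ω k) : gridValues N ω t k = ω.I t := by
  rw [gridValues, capTime_of_ge h]

theorem eventually_le_partTime (N : ℕ) (ω : PricePath) (t : ℝ≥0) :
    ∀ᶠ k in atTop, (t : ℝ≥0∞) ≤ partTime N ω k := by
  obtain ⟨k, hk⟩ := exists_le_partTime N ω t
  exact eventually_atTop.2 ⟨k, fun j hj => hk.trans (partTime_mono N ω hj)⟩

theorem eventually_gridValues (N : ℕ) (ω : PricePath) (t : ℝ≥0) :
    ∀ᶠ k in atTop, gridValues N ω t k = ω.I t :=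
  (eventually_le_partTime N ω t).mono fun _ => gridValues_of_ge

theorem abs_gridValues_succ_sub_le (N : ℕ) (ω : PricePath) (t : ℝ≥0) (k : ℕ) :
    |gridValues N ω t (k + 1) - gridValues N ω t k| ≤ (2 : ℝ)⁻¹ ^ N := by
  rcases le_total (t : ℝ≥0∞) (partTime N ω k) with h | h
  · rw [gridValues_of_ge h, gridValues_of_ge (h.trans (partTime_le_succ N ω k))]
    simp
  · rw [gridValues, gridValues, capTime_of_le h]
    refine abs_I_sub_le ?_ ?_
    · rw [coe_capTime]; exact le_min (partTime_le_succ N ω k) h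
    · rw [coe_capTime]; exact min_le_left _ _

theorem isGridPath_gridValues (N : ℕ) (ω : PricePath) (t : ℝ≥0) :
    IsGridPath N (gridValues N ω t) where
  zero := by simp [gridValues, partTime, ω.I_zero]
  pos k := ω.pos_I _
  step k := abs_gridValues_succ_sub_le N ω t k

/-- The holdings prescribed by the rule `F` at the time `T^N_k`. On the event `T^N_k = ∞`, where
the holdings are irrelevant, the path is truncated at the time `0`. -/
noncomputable def ruleHold (N : ℕ) (F : ℕ → (ℕ → ℝ) → ℝ) (k : ℕ) (ω : PricePath) : ℝ × ℝ :=
  (F k (gridValues N ω (partTime N ω k).toNNReal), 0)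

/-- The simple strategy that trades at the times `T^N_k` according to the rule `F`. -/
noncomputable def ruleStrategy {N : ℕ} {F : ℕ → (ℕ → ℝ) → ℝ} (hF : IsTradingRule N F) :
    SimpleStrategy where
  time k ω := partTime N ω k
  hold := ruleHold N F
  time_isStopTime := isStopTime_partTime N
  time_le_succ k ω := partTime_le_succ N ω k
  time_tendsto := tendsto_partTime N
  hold_measurable k := by
    refine ((hF.measurable k).comp ?_).prodMk measurable_const
    refine measurable_pi_lambda _ fun j => ?_
    exact (measurable_capTime.comp ((measurable_partTime N j).prodMk
      (measurable_partTime N k).ennreal_toNNReal)).pricePath_I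
  hold_bounded k := by
    obtain ⟨C, hC⟩ := hF.bounded k
    refine ⟨C, fun ω => ?_⟩
    have := hC _ (isGridPath_gridValues N ω (partTime N ω k).toNNReal)
    simpa [ruleHold, Prod.norm_def, abs_nonneg] using this
  hold_determined k ω ω' h := by
    have hk := partTime_determined N k h
    have : F k (gridValues N ω (partTime N ω k).toNNReal) =
        F k (gridValues N ω' (partTime N ω' k).toNNReal) := by
      refine hF.adapted k _ _ fun j hj => ?_
      have hj' : partTime N ω j ≤ partTime N ω k := partTime_mono N ω hj
      rw [gridValues, gridValues, ← hk, ← partTime_determined N j (h.mono hj')]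
      refine (h _ ?_).1
      rw [coe_capTime]
      exact (min_le_left _ _).trans hj'
    simp only [ruleHold, this]

/-- The capital of the strategy of a rule is the gain of the rule along the grid values, because
for `T^N_k ≤ t` the first `k` grid values do not depend on whether the path is truncated at
`T^N_k` or at `t`. -/
theorem simpleCapital_ruleStrategy {N : ℕ} {F : ℕ → (ℕ → ℝ) → ℝ} (hF : IsTradingRule N F)
    (c : ℝ) (t : ℝ≥0) (ω : PricePath) :
    ∀ᶠ K in atTop, simpleCapital (ruleStrategy hF) c t ω = c + gain F (gridValues N ω t) K := by
  filter_upwards [eventually_le_partTime N ω t] with K hK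
  rw [simpleCapital, gain]
  congr 1
  rw [tsum_eq_sum (s := Finset.range K)]
  · refine Finset.sum_congr rfl fun k _ => ?_
    simp only [ruleStrategy, ruleHold, zero_mul, add_zero]
    change _ * (gridValues N ω t (k + 1) - gridValues N ω t k) = _
    rcases le_total (t : ℝ≥0∞) (partTime N ω k) with h | h
    · rw [gridValues_of_ge h, gridValues_of_ge (h.trans (partTime_le_succ N ω k))]
      simp
    · congr 1
      refine hF.adapted k _ _ fun j hj => ?_
      have hj' : partTime N ω j ≤ partTime N ω k := partTime_mono N ω hj
      rw [gridValues, gridValues, capTime_of_le (hj'.trans h), capTime_of_le]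
      rwa [ENNReal.coe_toNNReal (ne_top_of_le_ne_top ENNReal.coe_ne_top h)]
  · intro k hk
    have h : (t : ℝ≥0∞) ≤ partTime N ω k :=
      hK.trans (partTime_mono N ω (by simpa using hk))
    simp only [ruleStrategy, capTime_of_ge h,
      capTime_of_ge (h.trans (partTime_le_succ N ω k)), sub_self, mul_zero, add_zero]

theorem simpleCapital_zero (G : SimpleStrategy) (c : ℝ) (ω : PricePath) :
    simpleCapital G c 0 ω = c := by
  simp [simpleCapital]

theorem isTestSupermartingale_rule {N : ℕ} {F : ℕ → (ℕ → ℝ) → ℝ} (hF : IsTradingRule N F) {c : ℝ}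
    (h0 : ∀ y, IsGridPath N y → ∀ K, 0 ≤ c + gain F y K) :
    IsTestSupermartingale fun t ω => (simpleCapital (ruleStrategy hF) c t ω : EReal) := by
  refine .simple _ _ fun t ω => ?_
  obtain ⟨K, hK⟩ := (simpleCapital_ruleStrategy hF c t ω).exists
  rw [hK]
  exact h0 _ (isGridPath_gridValues N ω t) K

/-! ### Closure properties of trading rules -/

theorem IsTradingRule.const (N : ℕ) (c : ℝ) : IsTradingRule N fun _ _ => c :=
  ⟨fun _ => measurable_const, fun _ _ _ _ => rfl, fun _ => ⟨|c|, fun _ _ => le_rfl⟩⟩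

theorem IsTradingRule.add {N : ℕ} {F G : ℕ → (ℕ → ℝ) → ℝ} (hF : IsTradingRule N F)
    (hG : IsTradingRule N G) : IsTradingRule N fun k y => F k y + G k y where
  measurable k := (hF.measurable k).add (hG.measurable k)
  adapted k y y' h := by rw [hF.adapted k y y' h, hG.adapted k y y' h]
  bounded k := by
    obtain ⟨C, hC⟩ := hF.bounded k
    obtain ⟨D, hD⟩ := hG.bounded k
    exact ⟨C + D, fun y hy => (abs_add_le _ _).trans (add_le_add (hC y hy) (hD y hy))⟩

theorem IsTradingRule.const_mul {N : ℕ} {F : ℕ → (ℕ → ℝ) → ℝ} (hF : IsTradingRule N F) (a : ℝ) :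
    IsTradingRule N fun k y => a * F k y where
  measurable k := (hF.measurable k).const_mul a
  adapted k y y' h := by rw [hF.adapted k y y' h]
  bounded k := by
    obtain ⟨C, hC⟩ := hF.bounded k
    refine ⟨|a| * C, fun y hy => ?_⟩
    rw [abs_mul]
    exact mul_le_mul_of_nonneg_left (hC y hy) (abs_nonneg a)

theorem IsTradingRule.sum {N : ℕ} {s : Finset ℕ} {F : ℕ → ℕ → (ℕ → ℝ) → ℝ}
    (hF : ∀ n ∈ s, IsTradingRule N (F n)) : IsTradingRule N fun k y => ∑ n ∈ s, F n k y := by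
  classical
  induction s using Finset.induction_on with
  | empty => simpa using IsTradingRule.const N 0
  | insert a s ha ih =>
    simp only [Finset.sum_insert ha]
    exact (hF a (by simp)).add (ih fun n hn => hF n (by simp [hn]))

theorem gain_add (F G : ℕ → (ℕ → ℝ) → ℝ) (y : ℕ → ℝ) (K : ℕ) :
    gain (fun k y => F k y + G k y) y K = gain F y K + gain G y K := by
  simp [gain, add_mul, Finset.sum_add_distrib]

theorem gain_const_mul (a : ℝ) (F : ℕ → (ℕ → ℝ) → ℝ) (y : ℕ → ℝ) (K : ℕ) :
    gain (fun k y => a * F k y) y K = a * gain F y K := by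
  simp [gain, Finset.mul_sum, mul_assoc]

theorem gain_sum (s : Finset ℕ) (F : ℕ → ℕ → (ℕ → ℝ) → ℝ) (y : ℕ → ℝ) (K : ℕ) :
    gain (fun k y => ∑ n ∈ s, F n k y) y K = ∑ n ∈ s, gain (F n) y K := by
  simp only [gain, Finset.sum_mul]
  exact Finset.sum_comm

/-! ### Leveraged portfolios -/

/-- The relative price change in the `k`-th period. -/
noncomputable def relStep (y : ℕ → ℝ) (k : ℕ) : ℝ := (y (k + 1) - y k) / y k

/-- The sum of the squared relative price changes in the first `k` periods. -/
noncomputable def relSq (y : ℕ → ℝ) (k : ℕ) : ℝ := ∑ j ∈ Finset.range k, relStep y j ^ 2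

theorem relSq_succ (y : ℕ → ℝ) (k : ℕ) : relSq y (k + 1) = relSq y k + relStep y k ^ 2 := by
  simp [relSq, Finset.sum_range_succ]

theorem relSq_mono (y : ℕ → ℝ) : Monotone (relSq y) :=
  monotone_nat_of_le_succ fun k => by rw [relSq_succ]; nlinarith [sq_nonneg (relStep y k)]

open Classical in
/-- The fraction of the capital that the portfolio with leverage `l` keeps invested in `I` during
the `k`-th period: `l` as long as the price is at least `b` and the accumulated squared returns
are below `q`, and `1` otherwise. -/
noncomputable def leverage (l b q : ℝ) (y : ℕ → ℝ) (k : ℕ) : ℝ :=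
  if b ≤ y k ∧ relSq y k < q then l else 1

/-- The capital, in units of `I`, of the portfolio that starts from one unit and is rebalanced at
the grid times so as to keep the fraction `leverage l b q y k` of the capital invested in `I`. -/
noncomputable def portfolio (l b q : ℝ) (y : ℕ → ℝ) : ℕ → ℝ
  | 0 => 1
  | k + 1 => portfolio l b q y k *
      ((y k + leverage l b q y k * (y (k + 1) - y k)) / y (k + 1))

/-- The holdings of `I` in the portfolio `portfolio l b q`. -/
noncomputable def portfolioRule (l b q : ℝ) (k : ℕ) (y : ℕ → ℝ) : ℝ :=
  leverage l b q y k * portfolio l b q y k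

section

variable {N : ℕ} {l b q : ℝ} {y y' : ℕ → ℝ} {k : ℕ}

/-- The portfolio is self-financing: its capital in cash is the capital of `portfolioRule` with
initial capital `1`. -/
theorem portfolio_mul_eq (hy : IsGridPath N y) (l b q : ℝ) (k : ℕ) :
    portfolio l b q y k * y k = 1 + gain (portfolioRule l b q) y k := by
  induction k with
  | zero => simp [portfolio, gain_zero, hy.zero]
  | succ k ih =>
    have := (hy.pos (k + 1)).ne'
    rw [gain_succ, ← add_assoc, ← ih, portfolio, portfolioRule]
    field_simp

/-- On a sufficiently fine grid the capital of the portfolio stays positive, because leverage is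
used only while the price is at least `b`. -/
theorem portfolio_factor_bounds (hy : IsGridPath N y) (h1 : (2 : ℝ)⁻¹ ^ N ≤ b / 2)
    (hl : |l| * (2 : ℝ)⁻¹ ^ N ≤ b / 2) (q : ℝ) (k : ℕ) :
    0 < (y k + leverage l b q y k * (y (k + 1) - y k)) / y (k + 1) ∧
      (y k + leverage l b q y k * (y (k + 1) - y k)) / y (k + 1) ≤ 4 := by
  have hpos := hy.pos (k + 1)
  have hs := hy.step k
  rw [div_le_iff₀ hpos]
  refine ⟨div_pos ?_ hpos, ?_⟩ <;> unfold leverage <;> split_ifs with h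
  all_goals try (have hb := h.1)
  all_goals try linarith
  all_goals
    have h2 : |l * (y (k + 1) - y k)| ≤ b / 2 := by
      rw [abs_mul]
      exact (mul_le_mul_of_nonneg_left hs (abs_nonneg l)).trans hl
    have h3 := abs_le.1 h2
    have h4 := abs_le.1 hs
    have h5 : (0 : ℝ) < (2 : ℝ)⁻¹ ^ N := by positivity
    linarith

theorem portfolio_pos (hy : IsGridPath N y) (h1 : (2 : ℝ)⁻¹ ^ N ≤ b / 2)
    (hl : |l| * (2 : ℝ)⁻¹ ^ N ≤ b / 2) (q : ℝ) (k : ℕ) : 0 < portfolio l b q y k := by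
  induction k with
  | zero => exact one_pos
  | succ k ih => exact mul_pos ih (portfolio_factor_bounds hy h1 hl q k).1

theorem portfolio_le (hy : IsGridPath N y) (h1 : (2 : ℝ)⁻¹ ^ N ≤ b / 2)
    (hl : |l| * (2 : ℝ)⁻¹ ^ N ≤ b / 2) (q : ℝ) (k : ℕ) : portfolio l b q y k ≤ 4 ^ k := by
  induction k with
  | zero => simp [portfolio]
  | succ k ih =>
    have h := portfolio_factor_bounds hy h1 hl q k
    exact mul_le_mul ih h.2 h.1.le (by positivity : (0 : ℝ) ≤ 4 ^ k)

theorem relStep_congr (h : ∀ j ≤ k + 1, y j = y' j) : relStep y k = relStep y' k := by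
  rw [relStep, relStep, h (k + 1) le_rfl, h k (by omega)]

theorem relSq_congr (h : ∀ j ≤ k, y j = y' j) : relSq y k = relSq y' k :=
  Finset.sum_congr rfl fun j hj => by
    rw [relStep_congr fun i hi => h i (by have := Finset.mem_range.1 hj; omega)]

theorem leverage_congr (h : ∀ j ≤ k, y j = y' j) : leverage l b q y k = leverage l b q y' k := by
  rw [leverage, leverage, relSq_congr h, h k le_rfl]

theorem portfolio_congr (h : ∀ j ≤ k, y j = y' j) :
    portfolio l b q y k = portfolio l b q y' k := by
  induction k with
  | zero => rfl
  | succ k ih =>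
    have h' : ∀ j ≤ k, y j = y' j := fun j hj => h j (by omega)
    rw [portfolio, portfolio, ih h', leverage_congr h', h (k + 1) le_rfl, h k (by omega)]

theorem measurable_relSq (k : ℕ) : Measurable fun y : ℕ → ℝ => relSq y k := by
  unfold relSq relStep
  fun_prop

theorem measurable_leverage (l b q : ℝ) (k : ℕ) :
    Measurable fun y : ℕ → ℝ => leverage l b q y k := by
  refine Measurable.ite ?_ measurable_const measurable_const
  exact (measurableSet_le measurable_const (measurable_pi_apply k)).inter
    (measurableSet_lt (measurable_relSq k) measurable_const)

theorem measurable_portfolio (l b q : ℝ) (k : ℕ) :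
    Measurable fun y : ℕ → ℝ => portfolio l b q y k := by
  induction k with
  | zero => exact measurable_const
  | succ k ih =>
    have := measurable_leverage l b q k
    unfold portfolio
    fun_prop

theorem isTradingRule_portfolioRule (h1 : (2 : ℝ)⁻¹ ^ N ≤ b / 2)
    (hl : |l| * (2 : ℝ)⁻¹ ^ N ≤ b / 2) (q : ℝ) : IsTradingRule N (portfolioRule l b q) where
  measurable k := (measurable_leverage l b q k).mul (measurable_portfolio l b q k)
  adapted k y y' h := by rw [portfolioRule, portfolioRule, leverage_congr h, portfolio_congr h]
  bounded k := by
    refine ⟨(|l| + 1) * 4 ^ k, fun y hy => ?_⟩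
    rw [portfolioRule, abs_mul, abs_of_pos (portfolio_pos hy h1 hl q k)]
    refine mul_le_mul ?_ (portfolio_le hy h1 hl q k) (portfolio_pos hy h1 hl q k).le
      (by positivity)
    unfold leverage
    split_ifs
    · linarith
    · simp

/-! ### Trading on the difference of two growth approximations -/

open Classical in
/-- The last among `y 0, …, y k` that was selected when `y 0` is selected and afterwards each
value that differs from the previously selected one by at least `2^{-n}`. -/
noncomputable def refPt (n : ℕ) (y : ℕ → ℝ) : ℕ → ℝ
  | 0 => y 0
  | k + 1 => if (2 : ℝ)⁻¹ ^ n ≤ |y (k + 1) - refPt n y k| then y (k + 1) else refPt n y k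

/-- The integrand of the difference of the growth approximations of the levels `n + 1` and `n`. -/
noncomputable def gap (n : ℕ) (y : ℕ → ℝ) (k : ℕ) : ℝ :=
  1 / refPt (n + 1) y k - 1 / refPt n y k

/-- The prices `y 0, …, y k` all lie in `[1 / (n + 1), n + 1]`. -/
def InZone (n : ℕ) (y : ℕ → ℝ) (k : ℕ) : Prop :=
  ∀ j ≤ k, 1 / ((n : ℝ) + 1) ≤ y j ∧ y j ≤ n + 1

open Classical in
/-- The integral of `gap n` along `y`, stopped when the price leaves the zone
`[1 / (n + 1), n + 1]` or the integral reaches `(3 / 4) ^ n` in absolute value. -/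
noncomputable def gapInt (n : ℕ) (y : ℕ → ℝ) : ℕ → ℝ
  | 0 => 0
  | k + 1 => gapInt n y k + if InZone n y k ∧ |gapInt n y k| < (3 / 4) ^ n
      then gap n y k * (y (k + 1) - y k) else 0

/-- The integral `gapInt n y` has not been stopped by the `k`-th grid time. -/
def GapActive (n : ℕ) (y : ℕ → ℝ) (k : ℕ) : Prop :=
  InZone n y k ∧ |gapInt n y k| < (3 / 4) ^ n

/-- A bound for `gap n` on the zone. -/
noncomputable def gapBound (n : ℕ) : ℝ := 2 * (2 : ℝ)⁻¹ ^ n * (n + 1) ^ 2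

open Classical in
/-- The trading rule whose capital dominates the square of `gapInt n`. -/
noncomputable def gapRule (n k : ℕ) (y : ℕ → ℝ) : ℝ :=
  if GapActive n y k then 2 * gapInt n y k * gap n y k - 2 * gapBound n ^ 2 * y k else 0

variable {n : ℕ}

theorem gapInt_succ_of_active (h : GapActive n y k) :
    gapInt n y (k + 1) = gapInt n y k + gap n y k * (y (k + 1) - y k) := by
  rw [gapInt, if_pos ⟨h.1, h.2⟩]

theorem gapInt_succ_of_not_active (h : ¬ GapActive n y k) :
    gapInt n y (k + 1) = gapInt n y k := by
  rw [gapInt, if_neg fun h' => h ⟨h'.1, h'.2⟩, add_zero]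

theorem GapActive.of_succ (h : GapActive n y (k + 1)) : GapActive n y k := by
  have h1 : InZone n y k := fun j hj => h.1 j (by omega)
  refine ⟨h1, ?_⟩
  by_contra h2
  have h3 := h.2
  rw [gapInt_succ_of_not_active fun h' => h2 h'.2] at h3
  exact h2 h3

theorem exists_refPt_eq (n : ℕ) (y : ℕ → ℝ) (k : ℕ) : ∃ j ≤ k, refPt n y k = y j := by
  induction k with
  | zero => exact ⟨0, le_rfl, rfl⟩
  | succ k ih =>
    rw [refPt]
    split_ifs
    · exact ⟨k + 1, le_rfl, rfl⟩
    · obtain ⟨j, hj, h⟩ := ih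
      exact ⟨j, by omega, h⟩

theorem abs_sub_refPt_le (n : ℕ) (y : ℕ → ℝ) (k : ℕ) : |y k - refPt n y k| ≤ (2 : ℝ)⁻¹ ^ n := by
  cases k with
  | zero => simp [refPt]
  | succ k =>
    rw [refPt]
    split_ifs with h
    · simp
    · exact (not_le.1 h).le

theorem abs_gap_le (h : InZone n y k) : |gap n y k| ≤ gapBound n := by
  obtain ⟨i, hi, hi'⟩ := exists_refPt_eq n y k
  obtain ⟨j, hj, hj'⟩ := exists_refPt_eq (n + 1) y k
  have h1 := abs_sub_refPt_le n y k
  have h2 := abs_sub_refPt_le (n + 1) y k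
  have hn : (0 : ℝ) < (n : ℝ) + 1 := by positivity
  rw [gap, gapBound]
  have ha : 1 / ((n : ℝ) + 1) ≤ refPt n y k := hi' ▸ (h i hi).1
  have hb : 1 / ((n : ℝ) + 1) ≤ refPt (n + 1) y k := hj' ▸ (h j hj).1
  set a := refPt n y k
  set c := refPt (n + 1) y k
  have hn' : 0 < 1 / ((n : ℝ) + 1) := by positivity
  have ha0 : 0 < a := hn'.trans_le ha
  have hc0 : 0 < c := hn'.trans_le hb
  have e : 1 / c - 1 / a = (a - c) * (1 / a * (1 / c)) := by field_simp
  have hia : 1 / a ≤ (n : ℝ) + 1 := by rwa [one_div_le ha0 hn]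
  have hic : 1 / c ≤ (n : ℝ) + 1 := by rwa [one_div_le hc0 hn]
  have hac : |a - c| ≤ 2 * (2 : ℝ)⁻¹ ^ n := by
    have h3 : (2 : ℝ)⁻¹ ^ (n + 1) ≤ (2 : ℝ)⁻¹ ^ n := by
      rw [pow_succ]
      have : (0 : ℝ) < (2 : ℝ)⁻¹ ^ n := by positivity
      linarith
    rw [abs_le] at *
    constructor <;> linarith
  rw [e, abs_mul, abs_of_pos (by positivity : 0 < 1 / a * (1 / c)), sq]
  gcongr

/-- The capital of `gapRule n` dominates the square of the stopped integral: the increments of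
`gapInt n y ^ 2` are those of the first part of the rule plus `(gap * Δy)^2`, and
`∑ (Δy)^2 = y ^ 2 - 1 - 2 ∑ y Δy`. -/
theorem gapInt_sq_le (hy : IsGridPath N y) (n k : ℕ) :
    gapInt n y k ^ 2 ≤ (gapBound n * (n + 2)) ^ 2 + gain (gapRule n) y k := by
  suffices H : gapInt n y k ^ 2 ≤ (gapBound n * (n + 2)) ^ 2 + gain (gapRule n) y k ∧
      (GapActive n y k → gapInt n y k ^ 2 + gapBound n ^ 2 * ((n + 2) ^ 2 - y k ^ 2) ≤
        (gapBound n * (n + 2)) ^ 2 + gain (gapRule n) y k) from H.1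
  induction k with
  | zero =>
    rw [gain_zero, hy.zero, gapInt]
    refine ⟨by rw [zero_pow two_ne_zero, add_zero]; positivity, fun _ => ?_⟩
    nlinarith [sq_nonneg (gapBound n)]
  | succ k ih =>
    rw [gain_succ, gapRule]
    by_cases h : GapActive n y k
    · rw [if_pos h, gapInt_succ_of_active h]
      have hk := ih.2 h
      have hg : gap n y k ^ 2 ≤ gapBound n ^ 2 := sq_le_sq' (abs_le.1 (abs_gap_le h.1)).1
        (abs_le.1 (abs_gap_le h.1)).2
      have hkey : (gapInt n y k + gap n y k * (y (k + 1) - y k)) ^ 2 +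
          gapBound n ^ 2 * ((n + 2) ^ 2 - y (k + 1) ^ 2) ≤ (gapBound n * (n + 2)) ^ 2 +
          (gain (gapRule n) y k + (2 * gapInt n y k * gap n y k - 2 * gapBound n ^ 2 * y k) *
            (y (k + 1) - y k)) := by
        nlinarith [mul_le_mul_of_nonneg_right hg (sq_nonneg (y (k + 1) - y k))]
      refine ⟨le_trans ?_ hkey, fun _ => hkey⟩
      have h1 : y (k + 1) ≤ n + 2 := by
        have h2 := (h.1 k le_rfl).2
        have h3 := (abs_le.1 (hy.step k)).2
        have h4 : (2 : ℝ)⁻¹ ^ N ≤ 1 := pow_le_one₀ (by norm_num) (by norm_num)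
        linarith
      have h2 : y (k + 1) ^ 2 ≤ (n + 2) ^ 2 := pow_le_pow_left₀ (hy.pos _).le h1 2
      nlinarith [mul_nonneg (sq_nonneg (gapBound n)) (sub_nonneg.2 h2)]
    · rw [if_neg h, gapInt_succ_of_not_active h, zero_mul, add_zero]
      exact ⟨ih.1, fun h' => absurd h'.of_succ h⟩

/-- Once the integral has reached `(3 / 4) ^ n`, so that it is stopped, it stays there. -/
theorem le_abs_gapInt_of_le {j : ℕ} (h : (3 / 4) ^ n ≤ |gapInt n y j|) (hj : j ≤ k) :
    (3 / 4) ^ n ≤ |gapInt n y k| := by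
  induction k, hj using Nat.le_induction with
  | base => exact h
  | succ k _ ih => rwa [gapInt_succ_of_not_active fun h' => absurd h'.2 (not_lt.2 ih)]

theorem refPt_congr (h : ∀ j ≤ k, y j = y' j) : refPt n y k = refPt n y' k := by
  induction k with
  | zero => exact h 0 le_rfl
  | succ k ih => rw [refPt, refPt, ih fun j hj => h j (by omega), h (k + 1) le_rfl]

theorem gap_congr (h : ∀ j ≤ k, y j = y' j) : gap n y k = gap n y' k := by
  rw [gap, gap, refPt_congr h, refPt_congr h]

theorem inZone_congr (h : ∀ j ≤ k, y j = y' j) : InZone n y k = InZone n y' k :=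
  propext (forall₂_congr fun j hj => by rw [h j hj])

theorem gapInt_congr (h : ∀ j ≤ k, y j = y' j) : gapInt n y k = gapInt n y' k := by
  induction k with
  | zero => rfl
  | succ k ih =>
    have h' : ∀ j ≤ k, y j = y' j := fun j hj => h j (by omega)
    rw [gapInt, gapInt, ih h', gap_congr h', h (k + 1) le_rfl, h k (by omega)]
    rw [inZone_congr h']

theorem gapRule_congr (h : ∀ j ≤ k, y j = y' j) : gapRule n k y = gapRule n k y' := by
  have e : GapActive n y k = GapActive n y' k := by
    rw [GapActive, GapActive, inZone_congr h, gapInt_congr h]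
  rw [gapRule, gapRule, e, gapInt_congr h, gap_congr h, h k le_rfl]

theorem measurable_refPt (n k : ℕ) : Measurable fun y : ℕ → ℝ => refPt n y k := by
  induction k with
  | zero => exact measurable_pi_apply 0
  | succ k ih =>
    refine Measurable.ite ?_ (measurable_pi_apply _) ih
    exact measurableSet_le measurable_const ((measurable_pi_apply _).sub ih).abs

theorem measurable_gap (n k : ℕ) : Measurable fun y : ℕ → ℝ => gap n y k :=
  ((measurable_refPt (n + 1) k).const_div 1).sub ((measurable_refPt n k).const_div 1)

theorem measurableSet_inZone (n k : ℕ) : MeasurableSet {y : ℕ → ℝ | InZone n y k} := by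
  have : {y : ℕ → ℝ | InZone n y k} =
      ⋂ j, ⋂ (_ : j ≤ k), {y : ℕ → ℝ | 1 / ((n : ℝ) + 1) ≤ y j ∧ y j ≤ n + 1} := by
    ext y
    simp [InZone]
  rw [this]
  exact MeasurableSet.iInter fun j => MeasurableSet.iInter fun _ =>
    (measurableSet_le measurable_const (measurable_pi_apply j)).inter
      (measurableSet_le (measurable_pi_apply j) measurable_const)

theorem measurable_gapInt (n k : ℕ) : Measurable fun y : ℕ → ℝ => gapInt n y k := by
  induction k with
  | zero => exact measurable_const
  | succ k ih =>
    refine ih.add (Measurable.ite ?_ ((measurable_gap n k).mul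
      ((measurable_pi_apply _).sub (measurable_pi_apply _))) measurable_const)
    exact (measurableSet_inZone n k).inter (measurableSet_lt ih.abs measurable_const)

theorem isTradingRule_gapRule (N n : ℕ) : IsTradingRule N (gapRule n) where
  measurable k := by
    refine Measurable.ite ((measurableSet_inZone n k).inter
      (measurableSet_lt (measurable_gapInt n k).abs measurable_const)) ?_ measurable_const
    exact (((measurable_gapInt n k).const_mul 2).mul (measurable_gap n k)).sub
      ((measurable_pi_apply k).const_mul _)
  adapted k y y' h := gapRule_congr h
  bounded k := by
    have hb : 0 ≤ gapBound n := by unfold gapBound; positivity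
    refine ⟨2 * (3 / 4) ^ n * gapBound n + 2 * gapBound n ^ 2 * (n + 1), fun y hy => ?_⟩
    rw [gapRule]
    split_ifs with h
    · refine (abs_sub _ _).trans (add_le_add ?_ ?_)
      · rw [abs_mul, abs_mul, abs_two]
        have h1 := h.2.le
        have h2 := abs_gap_le h.1
        gcongr
      · rw [abs_mul, abs_of_pos (hy.pos k), abs_of_nonneg (by positivity)]
        have := (h.1 k le_rfl).2
        gcongr
    · rw [abs_zero]
      positivity

/-- The initial capitals needed by the rules `gapRule n`, each scaled by the square of its
target `(3 / 4) ^ n`, have a finite sum. -/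
theorem summable_gapCost :
    Summable fun n : ℕ => (gapBound n * (n + 2)) ^ 2 / ((3 / 4 : ℝ) ^ n) ^ 2 := by
  have h : Summable fun n : ℕ => ((n + 2 : ℕ) : ℝ) ^ 6 * (4 / 9 : ℝ) ^ (n + 2) :=
    (summable_nat_add_iff 2).2
      (summable_pow_mul_geometric_of_norm_lt_one 6 (r := (4 / 9 : ℝ)) (by norm_num))
  refine Summable.of_nonneg_of_le (fun n => by positivity) (fun n => ?_) (h.mul_left (81 / 4))
  have e1 : (4 / 9 : ℝ) ^ (n + 2) = 16 / 81 * (4 / 9) ^ n := by rw [pow_add]; ring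
  have e2 : (4 / 9 : ℝ) ^ n = ((2 : ℝ)⁻¹ ^ n) ^ 2 / ((3 / 4 : ℝ) ^ n) ^ 2 := by
    rw [← pow_mul, ← pow_mul, mul_comm n 2, pow_mul, pow_mul, ← div_pow]
    norm_num
  rw [e1, e2, gapBound]
  have h3 : ((n : ℝ) + 1) ^ 4 ≤ (n + 2) ^ 4 := by gcongr; norm_num
  have h4 : 0 ≤ ((2 : ℝ)⁻¹ ^ n) ^ 2 / ((3 / 4 : ℝ) ^ n) ^ 2 := by positivity
  calc _ = 4 * (((n : ℝ) + 1) ^ 4 * (n + 2) ^ 2) *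
        (((2 : ℝ)⁻¹ ^ n) ^ 2 / ((3 / 4 : ℝ) ^ n) ^ 2) := by ring
    _ ≤ 4 * (((n : ℝ) + 2) ^ 4 * (n + 2) ^ 2) *
        (((2 : ℝ)⁻¹ ^ n) ^ 2 / ((3 / 4 : ℝ) ^ n) ^ 2) := by gcongr
    _ = _ := by push_cast; ring

end

/-! ### The growth approximations along finer partitions -/

theorem growthApprox_eq {n : ℕ} {ω : PricePath} {t : ℝ≥0} {K : ℕ}
    (h : (t : ℝ≥0∞) ≤ partTime n ω K) :
    growthApprox n ω t = ∑ k ∈ Finset.range K, relStep (gridValues n ω t) k := by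
  refine tsum_eq_sum fun k hk => ?_
  have hk' : (t : ℝ≥0∞) ≤ partTime n ω k := h.trans (partTime_mono n ω (by simpa using hk))
  rw [relIncr, capTime_of_ge hk', capTime_of_ge (hk'.trans (partTime_le_succ n ω k)), sub_self,
    zero_div]

theorem relQVApprox_eq {n : ℕ} {ω : PricePath} {t : ℝ≥0} {K : ℕ}
    (h : (t : ℝ≥0∞) ≤ partTime n ω K) : relQVApprox n ω t = relSq (gridValues n ω t) K := by
  refine tsum_eq_sum fun k hk => ?_
  have hk' : (t : ℝ≥0∞) ≤ partTime n ω k := h.trans (partTime_mono n ω (by simpa using hk))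
  rw [relIncr, capTime_of_ge hk', capTime_of_ge (hk'.trans (partTime_le_succ n ω k)), sub_self,
    zero_div, zero_pow two_ne_zero]

theorem growthApprox_zero (n : ℕ) (ω : PricePath) : growthApprox n ω 0 = 0 := by
  rw [growthApprox_eq (K := 0) (by simp)]
  simp

theorem relQVApprox_zero (n : ℕ) (ω : PricePath) : relQVApprox n ω 0 = 0 := by
  rw [relQVApprox_eq (K := 0) (by simp)]
  simp [relSq]

/-- Within a cell of the partition of level `n`, the growth approximation of that level is an
affine function of the price. -/
theorem growthApprox_sub_of_cell {n : ℕ} {ω : PricePath} {i : ℕ} {s s' : ℝ≥0}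
    (h1 : partTime n ω i ≤ s) (h2 : s ≤ s') (h3 : (s' : ℝ≥0∞) ≤ partTime n ω (i + 1)) :
    growthApprox n ω s' - growthApprox n ω s =
      (ω.I s' - ω.I s) / ω.I (partTime n ω i).toNNReal := by
  have h12 : (s : ℝ≥0∞) ≤ s' := ENNReal.coe_le_coe.2 h2
  have h1' := h1.trans h12
  rw [growthApprox_eq h3, growthApprox_eq (h12.trans h3), Finset.sum_range_succ,
    Finset.sum_range_succ]
  have e : ∀ k ∈ Finset.range i,
      relStep (gridValues n ω s') k = relStep (gridValues n ω s) k := by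
    intro k hk
    have hk1 : partTime n ω (k + 1) ≤ partTime n ω i :=
      partTime_mono n ω (by have := Finset.mem_range.1 hk; omega)
    have hk0 : partTime n ω k ≤ partTime n ω i :=
      partTime_mono n ω (Finset.mem_range.1 hk).le
    simp only [relStep, gridValues, capTime_of_le (hk1.trans h1), capTime_of_le (hk1.trans h1'),
      capTime_of_le (hk0.trans h1), capTime_of_le (hk0.trans h1')]
  rw [Finset.sum_congr rfl e, add_sub_add_left_eq_sub]
  simp only [relStep, gridValues, capTime_of_ge h3, capTime_of_ge (h12.trans h3),
    capTime_of_le h1, capTime_of_le h1']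
  ring

/-- The partition of level `N` refines the partition of each level `n ≤ N`: the price at
`T^n_{i+1}` lies on the lattice `2^{-N} ℤ`, so that this time cannot lie strictly between two
partition times of the level `N`. -/
theorem partTime_succ_le_of_cell {n N : ℕ} (hnN : n ≤ N) {ω : PricePath} {i k : ℕ}
    (hne : partTime N ω k ≠ ∞) (h1 : partTime n ω i ≤ partTime N ω k)
    (h2 : partTime N ω k < partTime n ω (i + 1)) :
    partTime N ω (k + 1) ≤ partTime n ω (i + 1) := by
  by_contra! hlt
  have hu : partTime n ω (i + 1) ≠ ∞ := hlt.ne_top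
  have hclose := abs_I_sub_lt (n := N) (k := k) (s := (partTime n ω (i + 1)).toNNReal)
    (by rw [ENNReal.coe_toNNReal hu]; exact h2.le) (by rwa [ENNReal.coe_toNNReal hu])
  obtain ⟨z, hz⟩ := exists_int_I_partTime hu
  obtain ⟨w, hw⟩ := exists_int_I_partTime hne
  have hp : (0 : ℝ) < (2 : ℝ)⁻¹ ^ N := by positivity
  have hz' : ω.I (partTime n ω (i + 1)).toNNReal =
      ((z * 2 ^ (N - n) : ℤ) : ℝ) * (2 : ℝ)⁻¹ ^ N := by
    rw [hz]
    obtain ⟨d, rfl⟩ := Nat.exists_eq_add_of_le hnN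
    rw [Nat.add_sub_cancel_left, pow_add]
    push_cast
    have : (2 : ℝ) ^ d * (2 : ℝ)⁻¹ ^ d = 1 := by rw [← mul_pow]; norm_num
    linear_combination -(z : ℝ) * (2 : ℝ)⁻¹ ^ n * this
  have heq : ω.I (partTime n ω (i + 1)).toNNReal = ω.I (partTime N ω k).toNNReal := by
    rw [hz', hw] at hclose ⊢
    rw [← sub_mul, abs_mul, abs_of_pos hp] at hclose
    have h3 : |(((z * 2 ^ (N - n) : ℤ) : ℝ) - w)| < 1 := by
      by_contra! h
      nlinarith
    have h4 : |z * 2 ^ (N - n) - w| < 1 := by exact_mod_cast h3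
    have h5 : z * 2 ^ (N - n) = w := by
      rw [Int.abs_lt_one_iff] at h4
      linarith
    rw [h5]
  have h6 := abs_I_partTime_succ hu
  rw [heq] at h6
  have h7 := abs_I_sub_lt (n := n) (ω := ω) (k := i) (s := (partTime N ω k).toNNReal)
    (by rwa [ENNReal.coe_toNNReal hne]) (by rwa [ENNReal.coe_toNNReal hne])
  exact absurd h6 h7.ne

/-- Along the grid of level `N`, the values selected by `refPt n` are the prices at the partition
times of the level `n ≤ N`. -/
theorem exists_refPt_cell {n N : ℕ} (hnN : n ≤ N) {ω : PricePath} {t : ℝ≥0} {k : ℕ}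
    (h : partTime N ω k ≤ t) :
    ∃ i, partTime n ω i ≤ partTime N ω k ∧ partTime N ω k < partTime n ω (i + 1) ∧
      refPt n (gridValues N ω t) k = ω.I (partTime n ω i).toNNReal := by
  induction k with
  | zero =>
    refine ⟨0, le_rfl, ?_, ?_⟩
    · exact partTime_lt_succ (n := n) (ω := ω) (k := 0) (by simp [partTime])
    · simp [refPt, gridValues, partTime]
  | succ k ih =>
    have hk := (partTime_le_succ N ω k).trans h
    have hne : partTime N ω k ≠ ∞ := ne_top_of_le_ne_top ENNReal.coe_ne_top hk
    have hne' : partTime N ω (k + 1) ≠ ∞ := ne_top_of_le_ne_top ENNReal.coe_ne_top h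
    obtain ⟨i, h1, h2, h3⟩ := ih hk
    have hle := partTime_succ_le_of_cell hnN hne h1 h2
    have hval : gridValues N ω t (k + 1) = ω.I (partTime N ω (k + 1)).toNNReal := by
      rw [gridValues, capTime_of_le h]
    rw [refPt, h3, hval]
    rcases hle.lt_or_eq with hlt | heq
    · have := abs_I_sub_lt (n := n) (ω := ω) (k := i) (s := (partTime N ω (k + 1)).toNNReal)
        (by rw [ENNReal.coe_toNNReal hne']; exact h1.trans (partTime_le_succ N ω k))
        (by rwa [ENNReal.coe_toNNReal hne'])
      exact ⟨i, h1.trans (partTime_le_succ N ω k), hlt, if_neg (not_le.2 this)⟩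
    · rw [heq] at hne' ⊢
      refine ⟨i + 1, le_rfl, partTime_lt_succ hne', if_pos ?_⟩
      rw [abs_I_partTime_succ hne']

theorem growthApprox_sub {n N : ℕ} (hnN : n ≤ N) {ω : PricePath} {s s' t : ℝ≥0} {k : ℕ}
    (ht : partTime N ω k ≤ t) (h1 : partTime N ω k ≤ s) (h2 : s ≤ s')
    (h3 : (s' : ℝ≥0∞) ≤ partTime N ω (k + 1)) :
    growthApprox n ω s' - growthApprox n ω s =
      (ω.I s' - ω.I s) / refPt n (gridValues N ω t) k := by
  obtain ⟨i, hi1, hi2, hi3⟩ := exists_refPt_cell hnN ht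
  have hne : partTime N ω k ≠ ∞ := ne_top_of_le_ne_top ENNReal.coe_ne_top ht
  rw [hi3]
  exact growthApprox_sub_of_cell (hi1.trans h1) h2
    (h3.trans (partTime_succ_le_of_cell hnN hne hi1 hi2))

/-- As long as it is not stopped, `gapInt n` is the difference of the growth approximations of the
levels `n + 1` and `n`. -/
theorem gapInt_eq_growthApprox_sub {n N : ℕ} (hnN : n + 1 ≤ N) {ω : PricePath} {t : ℝ≥0} {k : ℕ}
    (h : partTime N ω k ≤ t) (hact : GapActive n (gridValues N ω t) k) :
    gapInt n (gridValues N ω t) k =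
      growthApprox (n + 1) ω (partTime N ω k).toNNReal -
        growthApprox n ω (partTime N ω k).toNNReal := by
  induction k with
  | zero => simp [gapInt, partTime, growthApprox_zero]
  | succ k ih =>
    have hk := (partTime_le_succ N ω k).trans h
    have hne : partTime N ω k ≠ ∞ := ne_top_of_le_ne_top ENNReal.coe_ne_top hk
    have hne' : partTime N ω (k + 1) ≠ ∞ := ne_top_of_le_ne_top ENNReal.coe_ne_top h
    have h1 : partTime N ω k ≤ (partTime N ω k).toNNReal := by rw [ENNReal.coe_toNNReal hne]
    have h2 : (partTime N ω k).toNNReal ≤ (partTime N ω (k + 1)).toNNReal :=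
      ENNReal.toNNReal_mono hne' (partTime_le_succ N ω k)
    have h3 : ((partTime N ω (k + 1)).toNNReal : ℝ≥0∞) ≤ partTime N ω (k + 1) := by
      rw [ENNReal.coe_toNNReal hne']
    have e1 := growthApprox_sub (n := n) (by omega) hk h1 h2 h3
    have e2 := growthApprox_sub (n := n + 1) hnN hk h1 h2 h3
    rw [gapInt_succ_of_active hact.of_succ, ih hk hact.of_succ]
    have hv : gridValues N ω t (k + 1) = ω.I (partTime N ω (k + 1)).toNNReal := by
      rw [gridValues, capTime_of_le h]
    have hv' : gridValues N ω t k = ω.I (partTime N ω k).toNNReal := by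
      rw [gridValues, capTime_of_le hk]
    rw [gap, hv, hv', sub_mul, one_div_mul_eq_div, one_div_mul_eq_div, ← e1, ← e2]
    ring

/-- If the growth approximations of the levels `n` and `n + 1` differ by more than `(3 / 4) ^ n`
at some time before `t`, then the stopped integral has reached `(3 / 4) ^ n` by the time `t` on
all sufficiently fine grids. -/
theorem eventually_le_abs_gapInt {n : ℕ} {ω : PricePath} {s t : ℝ≥0} (hst : s ≤ t)
    (hzone : ∀ u ≤ t, 1 / ((n : ℝ) + 1) ≤ ω.I u ∧ ω.I u ≤ n + 1)
    (hs : (3 / 4) ^ n < |growthApprox (n + 1) ω s - growthApprox n ω s|) :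
    ∀ᶠ N in atTop, ∀ᶠ K in atTop, (3 / 4) ^ n ≤ |gapInt n (gridValues N ω t) K| := by
  have hlim : Tendsto (fun N : ℕ => gapBound n * (2 : ℝ)⁻¹ ^ N) atTop (𝓝 0) := by
    simpa using (tendsto_pow_atTop_nhds_zero_of_lt_one (r := (2 : ℝ)⁻¹) (by norm_num)
      (by norm_num)).const_mul (gapBound n)
  filter_upwards [hlim.eventually (gt_mem_nhds (sub_pos.2 hs)), eventually_ge_atTop (n + 1)]
    with N hN hnN
  obtain ⟨k, hk1, hk2⟩ := exists_mem_cell N ω s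
  have hkt : partTime N ω k ≤ t := hk1.trans (ENNReal.coe_le_coe.2 hst)
  filter_upwards [eventually_ge_atTop k] with K hK
  refine le_abs_gapInt_of_le ?_ hK
  by_contra! hlt
  have hact : GapActive n (gridValues N ω t) k := ⟨fun j _ => hzone _ (capTime_le _ _), hlt⟩
  have hne : partTime N ω k ≠ ∞ := ne_top_of_le_ne_top ENNReal.coe_ne_top hkt
  have e0 := gapInt_eq_growthApprox_sub hnN hkt hact
  have h1 : partTime N ω k ≤ (partTime N ω k).toNNReal := by rw [ENNReal.coe_toNNReal hne]
  have h2 : (partTime N ω k).toNNReal ≤ s := by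
    rwa [← ENNReal.coe_le_coe, ENNReal.coe_toNNReal hne]
  have e1 := growthApprox_sub (n := n) (by omega) hkt h1 h2 hk2.le
  have e2 := growthApprox_sub (n := n + 1) hnN hkt h1 h2 hk2.le
  have e3 : growthApprox (n + 1) ω s - growthApprox n ω s = gapInt n (gridValues N ω t) k +
      gap n (gridValues N ω t) k * (ω.I s - ω.I (partTime N ω k).toNNReal) := by
    rw [e0, gap, sub_mul, one_div_mul_eq_div, one_div_mul_eq_div, ← e1, ← e2]
    ring
  have h4 := abs_gap_le hact.1
  have h5 := abs_I_sub_lt hk1 hk2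
  have h6 : |gap n (gridValues N ω t) k * (ω.I s - ω.I (partTime N ω k).toNNReal)| ≤
      gapBound n * (2 : ℝ)⁻¹ ^ N := by
    rw [abs_mul]
    gcongr
    exact (abs_nonneg _).trans h4
  have h7 := abs_add_le (gapInt n (gridValues N ω t) k)
    (gap n (gridValues N ω t) k * (ω.I s - ω.I (partTime N ω k).toNNReal))
  rw [← e3] at h7
  linarith

/-! ### Growth, quadratic variation and the logarithm -/

theorem continuous_relIncr (n : ℕ) (ω : PricePath) (k : ℕ) :
    Continuous fun t => relIncr n ω t k := by
  have h := fun j => ω.continuous_I.comp (continuous_capTime (partTime n ω j))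
  exact ((h (k + 1)).sub (h k)).div (h k) fun t => (ω.pos_I _).ne'

theorem continuous_growthApprox (n : ℕ) (ω : PricePath) : Continuous (growthApprox n ω) := by
  refine continuous_iff_continuousAt.2 fun t => ?_
  obtain ⟨K, hK⟩ := exists_le_partTime n ω (t + 1)
  have hc : Continuous fun s => ∑ k ∈ Finset.range K, relIncr n ω s k :=
    continuous_finsetSum _ fun k _ => continuous_relIncr n ω k
  refine hc.continuousAt.congr ?_
  filter_upwards [gt_mem_nhds (show t < t + 1 by simp)] with s hs
  exact (growthApprox_eq ((ENNReal.coe_le_coe.2 hs.le).trans hK)).symm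

theorem continuous_relQVApprox (n : ℕ) (ω : PricePath) : Continuous (relQVApprox n ω) := by
  refine continuous_iff_continuousAt.2 fun t => ?_
  obtain ⟨K, hK⟩ := exists_le_partTime n ω (t + 1)
  have hc : Continuous fun s => ∑ k ∈ Finset.range K, relIncr n ω s k ^ 2 :=
    continuous_finsetSum _ fun k _ => (continuous_relIncr n ω k).pow 2
  refine hc.continuousAt.congr ?_
  filter_upwards [gt_mem_nhds (show t < t + 1 by simp)] with s hs
  exact (relQVApprox_eq ((ENNReal.coe_le_coe.2 hs.le).trans hK)).symm

theorem abs_log_one_add_sub_le {x : ℝ} (hx : |x| ≤ 1 / 2) :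
    |Real.log (1 + x) - (x - x ^ 2 / 2)| ≤ 2 * |x| * x ^ 2 := by
  have h := Real.abs_log_sub_add_sum_range_le (x := -x) (by rw [abs_neg]; linarith) 2
  rw [Finset.sum_range_succ, Finset.sum_range_one, abs_neg, sub_neg_eq_add] at h
  have e : (-x) ^ (0 + 1) / (((0 : ℕ) : ℝ) + 1) + (-x) ^ (1 + 1) / (((1 : ℕ) : ℝ) + 1) +
      Real.log (1 + x) = Real.log (1 + x) - (x - x ^ 2 / 2) := by
    push_cast
    ring
  rw [e] at h
  refine h.trans ?_
  rw [div_le_iff₀ (by linarith)]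
  have e2 : |x| ^ (2 + 1) = |x| * x ^ 2 := by rw [pow_succ, sq_abs]; ring
  rw [e2]
  nlinarith [mul_nonneg (abs_nonneg x) (sq_nonneg x)]

theorem one_add_relStep {N : ℕ} {y : ℕ → ℝ} (hy : IsGridPath N y) (k : ℕ) :
    1 + relStep y k = y (k + 1) / y k := by
  have := (hy.pos k).ne'
  rw [relStep]
  field_simp
  ring

theorem abs_relStep_le {N : ℕ} {y : ℕ → ℝ} (hy : IsGridPath N y) {b : ℝ} (hb : 0 < b) {k : ℕ}
    (h : b ≤ y k) : |relStep y k| ≤ (2 : ℝ)⁻¹ ^ N / b := by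
  rw [relStep, abs_div, abs_of_pos (hy.pos k)]
  have := hy.step k
  gcongr

/-- The second order expansion of the logarithm of the price. -/
theorem abs_log_sub_le {N : ℕ} {y : ℕ → ℝ} (hy : IsGridPath N y) {ρ : ℝ} (hρ : ρ ≤ 1 / 2) {K : ℕ}
    (h : ∀ k < K, |relStep y k| ≤ ρ) :
    |Real.log (y K) - (∑ k ∈ Finset.range K, relStep y k - relSq y K / 2)| ≤
      2 * ρ * relSq y K := by
  induction K with
  | zero => simp [hy.zero, relSq]
  | succ K ih =>
    have h1 := ih fun k hk => h k (by omega)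
    have h2 := h K (by omega)
    have h3 := abs_log_one_add_sub_le (h2.trans hρ)
    rw [one_add_relStep hy, Real.log_div (hy.pos _).ne' (hy.pos _).ne'] at h3
    have h4 : 2 * |relStep y K| * relStep y K ^ 2 ≤ 2 * ρ * relStep y K ^ 2 := by gcongr
    rw [Finset.sum_range_succ, relSq_succ]
    rw [abs_le] at *
    constructor <;> linarith [h1.1, h1.2, h3.1, h3.2]

theorem exists_pos_le_I (ω : PricePath) (t : ℝ≥0) : ∃ b > 0, ∀ s ≤ t, b ≤ ω.I s := by
  obtain ⟨u, -, hu⟩ := (isCompact_Icc (a := (0 : ℝ≥0)) (b := t)).exists_isMinOn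
    ⟨0, by simp⟩ ω.continuous_I.continuousOn
  exact ⟨ω.I u, ω.pos_I u, fun s hs => hu ⟨by simp, hs⟩⟩

theorem abs_log_I_sub_le {ω : PricePath} {t : ℝ≥0} {b : ℝ} (hb : 0 < b)
    (hbt : ∀ s ≤ t, b ≤ ω.I s) {n : ℕ} (hn : (2 : ℝ)⁻¹ ^ n / b ≤ 1 / 2) {s : ℝ≥0} (hs : s ≤ t) :
    |Real.log (ω.I s) - (growthApprox n ω s - relQVApprox n ω s / 2)| ≤
      2 * ((2 : ℝ)⁻¹ ^ n / b) * relQVApprox n ω s := by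
  obtain ⟨K, hK⟩ := exists_le_partTime n ω s
  rw [growthApprox_eq hK, relQVApprox_eq hK, ← gridValues_of_ge hK]
  exact abs_log_sub_le (isGridPath_gridValues n ω s) hn fun k _ =>
    abs_relStep_le (isGridPath_gridValues n ω s) hb (hbt _ ((capTime_le _ _).trans hs))

theorem tendsto_inv_two_pow_div (b : ℝ) :
    Tendsto (fun n : ℕ => (2 : ℝ)⁻¹ ^ n / b) atTop (𝓝 0) := by
  simpa using (tendsto_pow_atTop_nhds_zero_of_lt_one (r := (2 : ℝ)⁻¹) (by norm_num)
    (by norm_num)).div_const b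

theorem relQVApprox_nonneg (n : ℕ) (ω : PricePath) (t : ℝ≥0) : 0 ≤ relQVApprox n ω t :=
  tsum_nonneg fun _ => sq_nonneg _

/-- If the growth approximations converge uniformly on `[0, t]`, then so do the approximations of
the quadratic variation. -/
theorem tendstoUniformlyOn_relQV {ω : PricePath} {t : ℝ≥0}
    (h : TendstoUniformlyOn (fun n => growthApprox n ω) (growth ω) atTop (Icc 0 t)) :
    TendstoUniformlyOn (fun n => relQVApprox n ω) (relQV ω) atTop (Icc 0 t) := by
  have hc : ContinuousOn (fun s => growth ω s - Real.log (ω.I s)) (Icc 0 t) :=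
    (h.continuousOn (Frequently.of_forall fun n => (continuous_growthApprox n ω).continuousOn)).sub
      (ω.continuous_I.log fun s => (ω.pos_I s).ne').continuousOn
  obtain ⟨W, hW⟩ := isCompact_Icc.exists_bound_of_continuousOn hc
  have hW0 : 0 ≤ W := (norm_nonneg _).trans (hW 0 (by simp))
  obtain ⟨b, hb, hbt⟩ := exists_pos_le_I ω t
  have key : TendstoUniformlyOn (fun n => relQVApprox n ω)
      (fun s => 2 * (growth ω s - Real.log (ω.I s))) atTop (Icc 0 t) := by
    rw [Metric.tendstoUniformlyOn_iff] at h ⊢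
    intro ε hε
    -- With `ρ = 2^{-n} / b ≤ 1 / 8`, the expansion of the logarithm first bounds `Σ^n` by
    -- `4 (W + 1)`; then its error term `4 ρ Σ^n` tends to zero.
    have hρ := tendsto_inv_two_pow_div b
    have hρ' : Tendsto (fun n : ℕ => 16 * ((2 : ℝ)⁻¹ ^ n / b) * (W + 1)) atTop (𝓝 0) := by
      simpa using (hρ.const_mul 16).mul_const (W + 1)
    filter_upwards [h (min 1 (ε / 4)) (by positivity),
      hρ.eventually (gt_mem_nhds (show (0 : ℝ) < 1 / 8 by norm_num)),
      hρ'.eventually (gt_mem_nhds (show (0 : ℝ) < ε / 2 by positivity))] with n h1 h2 h3 s hs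
    have h4 := abs_log_I_sub_le hb hbt (h2.le.trans (by norm_num)) hs.2
    have h5 := h1 s hs
    have h6 := hW s hs
    have h7 : 0 ≤ (2 : ℝ)⁻¹ ^ n / b := by positivity
    set ρ := (2 : ℝ)⁻¹ ^ n / b
    have h8 := relQVApprox_nonneg n ω s
    set Q := relQVApprox n ω s
    rw [dist_comm, Real.dist_eq] at h5 ⊢
    rw [Real.norm_eq_abs] at h6
    obtain ⟨h5a, h5b⟩ := lt_min_iff.1 h5
    rw [abs_lt] at h5a h5b ⊢
    rw [abs_le] at h4 h6
    have h9 : Q ≤ 4 * (W + 1) := by nlinarith [h4.1, h4.2]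
    have h10 : 4 * ρ * Q ≤ 16 * ρ * (W + 1) := by nlinarith
    constructor <;> linarith [h4.1, h4.2, h5b.1, h5b.2]
  refine key.congr_right fun s hs => ?_
  exact (key.tendsto_at hs).limUnder_eq.symm

/-- If for all large `n` the growth approximations of the levels `n` and `n + 1` differ by at
most `(3 / 4) ^ n` on each compact interval, then the limits exist. -/
theorem limitsExist_of_eventually {ω : PricePath}
    (h : ∀ t : ℝ≥0, ∃ n₀, ∀ n ≥ n₀, ∀ s ≤ t,
      |growthApprox (n + 1) ω s - growthApprox n ω s| ≤ (3 / 4) ^ n) : LimitsExist ω := by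
  intro t
  have key : TendstoUniformlyOn (fun n => growthApprox n ω) (growth ω) atTop (Icc 0 t) := by
    obtain ⟨n₀, hn₀⟩ := h t
    have hd : ∀ s ≤ t, ∀ n, dist (growthApprox (n + n₀) ω s) (growthApprox (n + 1 + n₀) ω s) ≤
        (3 / 4) ^ n₀ * (3 / 4) ^ n := by
      intro s hs n
      rw [dist_comm, Real.dist_eq, ← pow_add, add_comm n₀ n, add_right_comm]
      exact hn₀ (n + n₀) (by omega) s hs
    have hlim : ∀ s ≤ t,
        Tendsto (fun n => growthApprox (n + n₀) ω s) atTop (𝓝 (growth ω s)) := by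
      intro s hs
      obtain ⟨L, hL⟩ := cauchySeq_tendsto_of_complete
        (cauchySeq_of_le_geometric (3 / 4) _ (by norm_num) (hd s hs))
      have : growth ω s = L := ((tendsto_add_atTop_iff_nat n₀).1 hL).limUnder_eq
      rwa [this]
    rw [Metric.tendstoUniformlyOn_iff]
    intro ε hε
    have hz : Tendsto (fun n : ℕ => (3 / 4 : ℝ) ^ n₀ * (3 / 4) ^ n / (1 - 3 / 4)) atTop (𝓝 0) := by
      simpa using ((tendsto_pow_atTop_nhds_zero_of_lt_one (r := (3 / 4 : ℝ)) (by norm_num)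
        (by norm_num)).const_mul ((3 / 4 : ℝ) ^ n₀)).div_const (1 - 3 / 4)
    have hev := hz.eventually (gt_mem_nhds hε)
    obtain ⟨n₁, hn₁⟩ := eventually_atTop.1 hev
    refine eventually_atTop.2 ⟨n₁ + n₀, fun n hn s hs => ?_⟩
    obtain ⟨d, rfl⟩ := Nat.exists_eq_add_of_le' (show n₀ ≤ n by omega)
    rw [dist_comm]
    exact (dist_le_of_le_geometric_of_tendsto (3 / 4) _ (by norm_num) (hd s hs.2) (hlim s hs.2)
      d).trans_lt (hn₁ d (by omega))
  exact ⟨tendstoUniformlyOn_relQV key, key⟩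

theorem LimitsExist.tendsto_relQV {ω : PricePath} (h : LimitsExist ω) (t : ℝ≥0) :
    Tendsto (fun n => relQVApprox n ω t) atTop (𝓝 (relQV ω t)) :=
  (h t).1.tendsto_at (by simp)

theorem LimitsExist.tendsto_growth {ω : PricePath} (h : LimitsExist ω) (t : ℝ≥0) :
    Tendsto (fun n => growthApprox n ω t) atTop (𝓝 (growth ω t)) :=
  (h t).2.tendsto_at (by simp)

/-- Pathwise form of Itô's formula for the logarithm. -/
theorem LimitsExist.log_I_eq {ω : PricePath} (h : LimitsExist ω) (t : ℝ≥0) :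
    Real.log (ω.I t) = growth ω t - relQV ω t / 2 := by
  obtain ⟨b, hb, hbt⟩ := exists_pos_le_I ω t
  have h1 := ((h.tendsto_growth t).sub ((h.tendsto_relQV t).div_const 2)).const_sub
    (Real.log (ω.I t))
  have hρ := tendsto_inv_two_pow_div b
  have h2 : Tendsto (fun n => 2 * ((2 : ℝ)⁻¹ ^ n / b) * relQVApprox n ω t) atTop (𝓝 0) := by
    simpa using (hρ.const_mul 2).mul (h.tendsto_relQV t)
  have h3 : Tendsto (fun n => Real.log (ω.I t) -
      (growthApprox n ω t - relQVApprox n ω t / 2)) atTop (𝓝 0) := by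
    refine squeeze_zero_norm' ?_ h2
    filter_upwards [hρ.eventually (gt_mem_nhds (show (0 : ℝ) < 1 / 2 by norm_num))] with n hn
    exact abs_log_I_sub_le hb hbt hn.le le_rfl
  linarith [tendsto_nhds_unique h1 h3]

theorem LimitsExist.continuous_relQV {ω : PricePath} (h : LimitsExist ω) :
    Continuous (relQV ω) := by
  refine continuous_iff_continuousAt.2 fun t => ?_
  have hc := (h (t + 1)).1.continuousOn
    (Frequently.of_forall fun n => (continuous_relQVApprox n ω).continuousOn)
  refine hc.continuousAt ?_
  have : Iio (t + 1) ⊆ Icc 0 (t + 1) := fun s hs => ⟨by simp, le_of_lt hs⟩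
  exact mem_of_superset (Iio_mem_nhds (by simp)) this

theorem LimitsExist.relQV_zero {ω : PricePath} (h : LimitsExist ω) : relQV ω 0 = 0 := by
  refine tendsto_nhds_unique (h.tendsto_relQV 0) ?_
  simp only [relQVApprox_zero]
  exact tendsto_const_nhds

/-- The quadratic variation first reaches the level `T` at the time `τ_T`, if that is finite. -/
theorem LimitsExist.hitTime_spec {ω : PricePath} (h : LimitsExist ω) {T : ℝ} (hT : 0 < T)
    (hfin : hitTime T ω < ∞) :
    relQV ω (hitTime T ω).toNNReal = T ∧ ∀ s < (hitTime T ω).toNNReal, relQV ω s < T := by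
  set B : Set ℝ≥0 := {t | T ≤ relQV ω t} with hB
  have hset : hitTime T ω = sInf ((↑) '' B : Set ℝ≥0∞) := by
    rw [hitTime]
    congr 1
    ext u
    constructor
    · rintro ⟨t, rfl, ht⟩
      exact ⟨t, ht, rfl⟩
    · rintro ⟨t, ht, rfl⟩
      exact ⟨t, rfl, ht⟩
  have hne : B.Nonempty := by
    by_contra hn
    rw [not_nonempty_iff_eq_empty] at hn
    rw [hset, hn] at hfin
    simp at hfin
  have hcl : IsClosed B := isClosed_le continuous_const h.continuous_relQV
  have hmem : sInf B ∈ B := hcl.csInf_mem hne (OrderBot.bddBelow _)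
  have hlow : ∀ s ∈ B, sInf B ≤ s := fun s hs => csInf_le (OrderBot.bddBelow _) hs
  have hτ : (hitTime T ω).toNNReal = sInf B := by
    have : hitTime T ω = (sInf B : ℝ≥0) := by
      rw [hset]
      refine IsLeast.csInf_eq ⟨mem_image_of_mem _ hmem, ?_⟩
      rintro _ ⟨t, ht, rfl⟩
      exact ENNReal.coe_le_coe.2 (hlow t ht)
    rw [this, ENNReal.toNNReal_coe]
  rw [hτ]
  have hlt : ∀ s < sInf B, relQV ω s < T := fun s hs => by
    by_contra! hge
    exact absurd (hlow s hge) (not_le.2 hs)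
  refine ⟨le_antisymm ?_ hmem, hlt⟩
  by_contra! hgt
  obtain ⟨u, hu, hu'⟩ := intermediate_value_Icc (show (0 : ℝ≥0) ≤ sInf B by simp)
    h.continuous_relQV.continuousOn (show T ∈ Icc _ _ from ⟨by rw [h.relQV_zero]; exact hT.le,
      hgt.le⟩)
  have : sInf B ≤ u := hlow u hu'.ge
  rw [le_antisymm hu.2 this] at hu'
  exact hgt.ne' hu'

/-- At the time `τ_T`, Itô's formula reads `ln I - T / 2 = M - T`. -/
theorem growthEvent_eq_logEvent {T : ℝ} (hT : 0 < T) (r : ℝ) :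
    growthEvent T r = logEvent T r := by
  ext ω
  refine and_congr_right fun h => forall_congr' fun hfin => ?_
  have h1 := (h.hitTime_spec hT hfin).1
  have h2 := h.log_I_eq (hitTime T ω).toNNReal
  rw [h1] at h2
  rw [h2]
  ring_nf

/-! ### The capital of a leveraged portfolio when the quadratic variation reaches a level -/

/-- A bound for the third order terms in the logarithm of the capital of a portfolio with
leverage `l`. -/
noncomputable def leverageConst (l : ℝ) : ℝ := 2 * |l| + 2 * |l| ^ 3

theorem log_leverage_factor_ge {l m ρ : ℝ} (hm : |m| ≤ ρ) (hρ : (1 + |l|) * ρ ≤ 1 / 2) :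
    (l - 1) * Real.log (1 + m) + (l - l ^ 2) / 2 * m ^ 2 - leverageConst l * ρ * m ^ 2 ≤
      Real.log (1 + l * m) - Real.log (1 + m) := by
  have hl := abs_nonneg l
  have hρ0 := (abs_nonneg m).trans hm
  have h1 := abs_log_one_add_sub_le (x := m) (by nlinarith)
  have hlm : |l * m| = |l| * |m| := abs_mul l m
  have h2 := abs_log_one_add_sub_le (x := l * m) (by rw [hlm]; nlinarith)
  have h3 : |l * (Real.log (1 + m) - (m - m ^ 2 / 2))| ≤ |l| * (2 * |m| * m ^ 2) := by
    rw [abs_mul]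
    gcongr
  have h4 : 2 * |l * m| * (l * m) ^ 2 = 2 * |l| ^ 3 * (|m| * m ^ 2) := by
    rw [hlm, mul_pow, ← sq_abs l]
    ring
  rw [h4] at h2
  have h5 : |m| * m ^ 2 ≤ ρ * m ^ 2 := by gcongr
  have h6 : leverageConst l * (|m| * m ^ 2) ≤ leverageConst l * (ρ * m ^ 2) := by
    unfold leverageConst
    gcongr
  unfold leverageConst at *
  rw [abs_le] at h2 h3
  nlinarith [h2.1, h3.2]

theorem log_portfolio_ge {N : ℕ} {l b q ρ : ℝ} {y : ℕ → ℝ} {K : ℕ} (hy : IsGridPath N y)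
    (h1 : (2 : ℝ)⁻¹ ^ N ≤ b / 2) (hl : |l| * (2 : ℝ)⁻¹ ^ N ≤ b / 2) (hρ : (1 + |l|) * ρ ≤ 1 / 2)
    (h : ∀ k < K, b ≤ y k ∧ relSq y k < q ∧ |relStep y k| ≤ ρ) :
    (l - 1) * Real.log (y K) + (l - l ^ 2) / 2 * relSq y K - leverageConst l * ρ * relSq y K ≤
      Real.log (portfolio l b q y K) := by
  induction K with
  | zero => simp [hy.zero, relSq, portfolio]
  | succ K ih =>
    have hK := h K (by omega)
    have h2 := ih fun k hk => h k (by omega)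
    have h3 := log_leverage_factor_ge hK.2.2 hρ
    have hpos := hy.pos K
    have hpos' := hy.pos (K + 1)
    have hf := (portfolio_factor_bounds hy h1 hl q K).1
    have hlev : leverage l b q y K = l := if_pos ⟨hK.1, hK.2.1⟩
    have e : (y K + leverage l b q y K * (y (K + 1) - y K)) / y (K + 1) =
        (1 + l * relStep y K) / (1 + relStep y K) := by
      rw [one_add_relStep hy, hlev, relStep]
      field_simp
    have hden : 0 < 1 + relStep y K := by rw [one_add_relStep hy]; positivity
    have hnum : 0 < 1 + l * relStep y K := by
      rw [e] at hf
      exact (div_pos_iff_of_pos_right hden).1 hf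
    rw [portfolio, Real.log_mul (portfolio_pos hy h1 hl q K).ne' hf.ne', e,
      Real.log_div hnum.ne' hden.ne', relSq_succ]
    have h4 : Real.log (1 + relStep y K) = Real.log (y (K + 1)) - Real.log (y K) := by
      rw [one_add_relStep hy, Real.log_div hpos'.ne' hpos.ne']
    rw [h4] at h3 ⊢
    linarith

/-- Once the squared returns have reached `q`, the portfolio is invested in `I` alone. -/
theorem portfolio_eq_of_le {N : ℕ} {l b q : ℝ} {y : ℕ → ℝ} {j k : ℕ} (hy : IsGridPath N y)
    (h : q ≤ relSq y j) (hjk : j ≤ k) : portfolio l b q y k = portfolio l b q y j := by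
  induction k, hjk using Nat.le_induction with
  | base => rfl
  | succ k hk ih =>
    have hlev : leverage l b q y k = 1 :=
      if_neg fun h' => absurd h'.2 (not_lt.2 (h.trans (relSq_mono y hk)))
    have := (hy.pos (k + 1)).ne'
    rw [portfolio, hlev, one_mul, add_sub_cancel, div_self this, mul_one, ih]

theorem gridValues_congr {N : ℕ} {ω : PricePath} {s t : ℝ≥0} {k : ℕ} (hs : partTime N ω k ≤ s)
    (hst : s ≤ t) : ∀ j ≤ k, gridValues N ω s j = gridValues N ω t j := by
  intro j hj
  have h1 := (partTime_mono N ω hj).trans hs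
  rw [gridValues, gridValues, capTime_of_le h1,
    capTime_of_le (h1.trans (ENNReal.coe_le_coe.2 hst))]

/-- Let the quadratic variation first reach `T` at the time `τ`. The portfolio of leverage `l`
that switches to `I` when the squared returns add up to `T - η` has, from `τ` on, a capital in
units of `I` close to `exp ((l - 1) ln I_τ + (l - l²) T / 2)` or greater. The margin `η` is needed
because the approximations of the quadratic variation may stay below `T` until long after `τ`. -/
theorem eventually_le_portfolio {ω : PricePath} (hω : LimitsExist ω) {T : ℝ} (hT : 0 < T)
    {τ t : ℝ≥0} (hτ : relQV ω τ = T) (hlt : ∀ s < τ, relQV ω s < T) (hτt : τ ≤ t) (l : ℝ) {ε : ℝ}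
    (hε : 0 < ε) :
    ∃ η₀ > 0, ∀ η, 0 < η → η < η₀ → ∀ᶠ N : ℕ in atTop,
      ((2 : ℝ)⁻¹ ^ N ≤ 1 / ((N : ℝ) + 1) / 2 → |l| * (2 : ℝ)⁻¹ ^ N ≤ 1 / ((N : ℝ) + 1) / 2 →
        ∀ᶠ K in atTop,
          Real.exp ((l - 1) * Real.log (ω.I τ) + (l - l ^ 2) / 2 * T - ε) ≤
            portfolio l (1 / ((N : ℝ) + 1)) (T - η) (gridValues N ω t) K) := by
  have hC : 0 ≤ leverageConst l := by unfold leverageConst; positivity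
  set κ := |l - 1| + |(l - l ^ 2) / 2| + leverageConst l * (T + 1) + 1 with hκ
  have hκ0 : 0 < κ := by positivity
  obtain ⟨γ, hγ0, hγ1, hγε⟩ : ∃ γ > 0, γ ≤ 1 ∧ γ * κ ≤ ε :=
    ⟨min 1 (ε / κ), by positivity, min_le_left _ _,
      (mul_le_mul_of_nonneg_right (min_le_right _ _) hκ0.le).trans (div_mul_cancel₀ _ hκ0.ne').le⟩
  have hτ0 : 0 < τ := by
    rw [pos_iff_ne_zero]
    rintro rfl
    rw [hω.relQV_zero] at hτ
    exact hT.ne hτ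
  have hcl : ContinuousAt (fun s => Real.log (ω.I s)) τ :=
    (ω.continuous_I.log fun s => (ω.pos_I s).ne').continuousAt
  obtain ⟨u, huτ, hu⟩ := exists_Ioc_subset_of_mem_nhds
    (hcl.preimage_mem_nhds (Metric.closedBall_mem_nhds _ hγ0)) ⟨0, hτ0⟩
  obtain ⟨v, hv, hvmax⟩ := (isCompact_Icc (a := (0 : ℝ≥0)) (b := u)).exists_isMaxOn
    ⟨0, by simp⟩ hω.continuous_relQV.continuousOn
  have hq₀ : relQV ω v < T := hlt v (hv.2.trans_lt huτ)
  refine ⟨min γ (T - relQV ω v), lt_min hγ0 (sub_pos.2 hq₀), fun η hη hη₀ => ?_⟩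
  obtain ⟨hηγ, hηq⟩ := lt_min_iff.1 hη₀
  obtain ⟨b, hb, hbt⟩ := exists_pos_le_I ω t
  have hρ := tendsto_inv_two_pow_div b
  have hρ1 : Tendsto (fun N : ℕ => (1 + |l|) * ((2 : ℝ)⁻¹ ^ N / b)) atTop (𝓝 0) := by
    simpa using hρ.const_mul (1 + |l|)
  have hρ2 : Tendsto (fun N : ℕ => ((2 : ℝ)⁻¹ ^ N / b) ^ 2) atTop (𝓝 0) := by
    simpa using hρ.pow 2
  filter_upwards [Metric.tendstoUniformlyOn_iff.1 (hω τ).1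
      (min (η / 2) (T - η - relQV ω v)) (lt_min (by positivity) (by linarith)),
    hρ.eventually (gt_mem_nhds hγ0),
    hρ1.eventually (gt_mem_nhds (show (0 : ℝ) < 1 / 2 by norm_num)),
    hρ2.eventually (gt_mem_nhds (show 0 < η / 2 by positivity)),
    (tendsto_one_div_add_atTop_nhds_zero_nat (𝕜 := ℝ)).eventually (gt_mem_nhds hb)]
    with N hN hNγ hN1 hN2 hNb h2N hlN
  have hclose : ∀ s ≤ τ, |relQVApprox N ω s - relQV ω s| < η / 2 ∧
      |relQVApprox N ω s - relQV ω s| < T - η - relQV ω v := fun s hs => by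
    have := hN s ⟨by simp, hs⟩
    rwa [dist_comm, Real.dist_eq, lt_min_iff] at this
  have hy := isGridPath_gridValues N ω t
  set y := gridValues N ω t with hydef
  set ρ := (2 : ℝ)⁻¹ ^ N / b
  have hby : ∀ k, b ≤ y k := fun k => hbt _ (capTime_le _ _)
  have hstep : ∀ k, |relStep y k| ≤ ρ := fun k => abs_relStep_le hy hb (hby k)
  obtain ⟨k, hk1, hk2⟩ := exists_mem_cell N ω τ
  have hQτ : relQVApprox N ω τ = relSq y k + relStep (gridValues N ω τ) k ^ 2 := by
    rw [relQVApprox_eq hk2.le, relSq_succ, relSq_congr (gridValues_congr hk1 hτt)]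
  have hlast : relStep (gridValues N ω τ) k ^ 2 ≤ ρ ^ 2 := by
    refine sq_le_sq' ?_ ?_ <;> have := abs_le.1 (abs_relStep_le (isGridPath_gridValues N ω τ) hb
      (k := k) (hbt _ ((capTime_le _ _).trans hτt)))
    · exact this.1
    · exact this.2
  have hcτ := abs_lt.1 (hclose τ le_rfl).1
  have hqk : T - η ≤ relSq y k := by linarith [hcτ.1]
  -- `s` is the grid time at which the portfolio switches to `I`; it lies in `(u, τ]`.
  classical
  have hex : ∃ j, T - η ≤ relSq y j := ⟨k, hqk⟩
  set j := Nat.find hex with hj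
  have hjk : j ≤ k := Nat.find_min' hex hqk
  have hjq : T - η ≤ relSq y j := Nat.find_spec hex
  have hjτ : partTime N ω j ≤ τ := (partTime_mono N ω hjk).trans hk1
  have hjne : partTime N ω j ≠ ∞ := ne_top_of_le_ne_top ENNReal.coe_ne_top hjτ
  obtain ⟨s, hs⟩ : ∃ s : ℝ≥0, (s : ℝ≥0∞) = partTime N ω j := ⟨_, ENNReal.coe_toNNReal hjne⟩
  have hsτ : s ≤ τ := by rwa [← ENNReal.coe_le_coe, hs]
  have hQs : relSq y j = relQVApprox N ω s := by
    rw [relQVApprox_eq hs.le, relSq_congr (gridValues_congr hs.ge (hsτ.trans hτt))]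
  have hys : y j = ω.I s := by
    rw [hydef, gridValues, capTime_of_le (hjτ.trans (ENNReal.coe_le_coe.2 hτt)), ← hs,
      ENNReal.toNNReal_coe]
  have hus : u < s := by
    by_contra! hsu
    have h1 : relQV ω s ≤ relQV ω v := hvmax (show s ∈ Icc 0 u from ⟨by simp, hsu⟩)
    have h2 := abs_lt.1 (hclose s hsτ).2
    linarith [h2.2]
  have hlog : |Real.log (ω.I s) - Real.log (ω.I τ)| ≤ γ := by
    have := hu ⟨hus, hsτ⟩
    rwa [mem_preimage, Metric.mem_closedBall, Real.dist_eq] at this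
  have hlow := log_portfolio_ge (q := T - η) hy h2N hlN hN1.le (K := j) fun i hi =>
    ⟨hNb.le.trans (hby i), not_le.1 (Nat.find_min hex hi), hstep i⟩
  have hQup : relSq y j ≤ T + γ := by
    have h1 := relSq_mono y hjk
    linarith [sq_nonneg (relStep (gridValues N ω τ) k), hcτ.2]
  have hQabs : |relSq y j - T| ≤ γ := abs_le.2 ⟨by linarith, by linarith⟩
  filter_upwards [eventually_ge_atTop j] with K hK
  rw [portfolio_eq_of_le hy hjq hK, ← Real.le_log_iff_exp_le (portfolio_pos hy h2N hlN _ _)]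
  refine le_trans ?_ hlow
  rw [hys]
  have e1 : |(l - 1) * (Real.log (ω.I s) - Real.log (ω.I τ))| ≤ |l - 1| * γ := by
    rw [abs_mul]; gcongr
  have e2 : |(l - l ^ 2) / 2 * (relSq y j - T)| ≤ |(l - l ^ 2) / 2| * γ := by
    rw [abs_mul]; gcongr
  have e3 : leverageConst l * ρ * relSq y j ≤ leverageConst l * γ * (T + 1) := by
    have h0 : 0 ≤ relSq y j := hQs ▸ relQVApprox_nonneg N ω s
    gcongr
    linarith
  have e4 := (abs_le.1 e1).1
  have e5 := (abs_le.1 e2).1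
  have e6 : γ * κ = |l - 1| * γ + |(l - l ^ 2) / 2| * γ + leverageConst l * γ * (T + 1) + γ := by
    rw [hκ]; ring
  linarith

/-! ### The combined strategy -/

/-- The total cost of the rules `gapRule n` scaled by the squares of their targets. -/
noncomputable def gapCost : ℝ := ∑' n : ℕ, (gapBound n * (n + 2)) ^ 2 / ((3 / 4 : ℝ) ^ n) ^ 2

theorem gapCost_nonneg : 0 ≤ gapCost := tsum_nonneg fun _ => by positivity

/-- The rule on the grid `N` that invests `ε` in the rules `gapRule n`, `n < N`, and `δ / 2` in
each of the two portfolios with leverages `1 + θ` and `1 - θ`. -/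
noncomputable def totalRule (δ ε θ q : ℝ) (N k : ℕ) (y : ℕ → ℝ) : ℝ :=
  ε / (gapCost + 1) * (∑ n ∈ Finset.range N, 1 / ((3 / 4 : ℝ) ^ n) ^ 2 * gapRule n k y) +
    δ / 2 * (portfolioRule (1 + θ) (1 / ((N : ℝ) + 1)) q k y +
      portfolioRule (1 - θ) (1 / ((N : ℝ) + 1)) q k y)

/-- The grid `N` is fine enough for trading with the leverage `l` as long as the price is at least
`1 / (N + 1)`. -/
def FineFor (l : ℝ) (N : ℕ) : Prop :=
  (2 : ℝ)⁻¹ ^ N ≤ 1 / ((N : ℝ) + 1) / 2 ∧ |l| * (2 : ℝ)⁻¹ ^ N ≤ 1 / ((N : ℝ) + 1) / 2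

theorem eventually_fineFor (l : ℝ) : ∀ᶠ N in atTop, FineFor l N := by
  have h1 : Tendsto (fun N : ℕ => ((N : ℝ) + 1) * (2 : ℝ)⁻¹ ^ N) atTop (𝓝 0) := by
    have := (tendsto_self_mul_const_pow_of_lt_one (r := (2 : ℝ)⁻¹) (by norm_num)
      (by norm_num)).add (tendsto_pow_atTop_nhds_zero_of_lt_one (r := (2 : ℝ)⁻¹) (by norm_num)
      (by norm_num))
    simpa [add_mul] using this
  have h2 := h1.const_mul |l|
  rw [mul_zero] at h2
  filter_upwards [h1.eventually (gt_mem_nhds (show (0 : ℝ) < 1 / 2 by norm_num)),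
    h2.eventually (gt_mem_nhds (show (0 : ℝ) < 1 / 2 by norm_num))] with N hN hN'
  have h3 : 0 < (N : ℝ) + 1 := by positivity
  constructor
  · rw [div_right_comm, le_div_iff₀ h3]
    linarith
  · rw [div_right_comm, le_div_iff₀ h3]
    linarith

theorem isTradingRule_totalRule {δ ε θ q : ℝ} {N : ℕ} (h1 : FineFor (1 + θ) N)
    (h2 : FineFor (1 - θ) N) : IsTradingRule N (totalRule δ ε θ q N) :=
  ((IsTradingRule.sum fun n _ => (isTradingRule_gapRule N n).const_mul _).const_mul _).add
    (((isTradingRule_portfolioRule h1.1 h1.2 q).add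
      (isTradingRule_portfolioRule h2.1 h2.2 q)).const_mul _)

/-- The capital of the combined strategy dominates the scaled squares of the stopped integrals and
the capitals of the two portfolios. -/
theorem le_totalRule_capital {δ ε θ q : ℝ} {N : ℕ} (hε : 0 < ε) {y : ℕ → ℝ} (hy : IsGridPath N y)
    (K : ℕ) :
    ε / (gapCost + 1) * (∑ n ∈ Finset.range N, (gapInt n y K / (3 / 4) ^ n) ^ 2) +
        δ / 2 * (portfolio (1 + θ) (1 / ((N : ℝ) + 1)) q y K * y K +
          portfolio (1 - θ) (1 / ((N : ℝ) + 1)) q y K * y K) ≤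
      δ + ε + gain (totalRule δ ε θ q N) y K := by
  have hS := gapCost_nonneg
  have e : gain (totalRule δ ε θ q N) y K = ε / (gapCost + 1) *
      (∑ n ∈ Finset.range N, 1 / ((3 / 4 : ℝ) ^ n) ^ 2 * gain (gapRule n) y K) + δ / 2 *
      (gain (portfolioRule (1 + θ) (1 / ((N : ℝ) + 1)) q) y K +
        gain (portfolioRule (1 - θ) (1 / ((N : ℝ) + 1)) q) y K) := by
    unfold totalRule
    rw [gain_add, gain_const_mul, gain_const_mul, gain_sum, gain_add]
    simp only [gain_const_mul]
  rw [e, portfolio_mul_eq hy, portfolio_mul_eq hy]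
  have h1 : ∑ n ∈ Finset.range N, (gapInt n y K / (3 / 4) ^ n) ^ 2 ≤
      gapCost + ∑ n ∈ Finset.range N, 1 / ((3 / 4 : ℝ) ^ n) ^ 2 * gain (gapRule n) y K := by
    refine le_trans ?_ (add_le_add_left (summable_gapCost.sum_le_tsum (Finset.range N)
      fun _ _ => by positivity) _)
    rw [← Finset.sum_add_distrib]
    refine Finset.sum_le_sum fun n _ => ?_
    rw [div_pow, one_div_mul_eq_div, ← add_div]
    gcongr
    exact gapInt_sq_le hy n K
  have h2 : 0 < ε / (gapCost + 1) := by positivity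
  have h3 : ε / (gapCost + 1) * (gapCost + 1) = ε := div_mul_cancel₀ _ (by positivity)
  nlinarith [mul_le_mul_of_nonneg_left h1 h2.le]

/-- Where the limits do not exist, the capital of the combined strategy tends to infinity as the
grid becomes finer. -/
theorem eventually_le_capital_of_not_limitsExist {ω : PricePath} (hω : ¬ LimitsExist ω) :
    ∃ t₀, ∀ t ≥ t₀, ∀ c R : ℝ, 0 < c → ∀ᶠ N in atTop, ∀ᶠ K in atTop,
      R ≤ c * ∑ n ∈ Finset.range N, (gapInt n (gridValues N ω t) K / (3 / 4) ^ n) ^ 2 := by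
  have hbad : ∃ t₀ : ℝ≥0, ∀ n₀, ∃ n ≥ n₀, ∃ s ≤ t₀,
      (3 / 4) ^ n < |growthApprox (n + 1) ω s - growthApprox n ω s| := by
    by_contra! h
    exact hω (limitsExist_of_eventually h)
  obtain ⟨t₀, ht₀⟩ := hbad
  refine ⟨t₀, fun t ht c R hc => ?_⟩
  obtain ⟨b, hb, hbt⟩ := exists_pos_le_I ω t
  obtain ⟨B, hB⟩ := isCompact_Icc.exists_bound_of_continuousOn
    (ω.continuous_I.continuousOn (s := Icc 0 t))
  obtain ⟨n₁, hn₁⟩ := eventually_atTop.1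
    (((tendsto_one_div_add_atTop_nhds_zero_nat (𝕜 := ℝ)).eventually (gt_mem_nhds hb)).and
      ((tendsto_natCast_atTop_atTop (R := ℝ)).eventually_ge_atTop B))
  set bad : Set ℕ := {n | n₁ ≤ n ∧ ∃ s ≤ t₀,
    (3 / 4) ^ n < |growthApprox (n + 1) ω s - growthApprox n ω s|} with hbaddef
  have hinf : bad.Infinite := by
    refine infinite_of_not_bddAbove fun ⟨M, hM⟩ => ?_
    obtain ⟨n, hn, hs⟩ := ht₀ (max n₁ (M + 1))
    have := hM (show n ∈ bad from ⟨(le_max_left _ _).trans hn, hs⟩)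
    have := (le_max_right n₁ (M + 1)).trans hn
    omega
  obtain ⟨m, hm⟩ := exists_nat_ge (R / c)
  obtain ⟨s, hs, hcard⟩ := hinf.exists_subset_card_eq m
  have hall : ∀ᶠ N in atTop, ∀ n ∈ s, (∀ᶠ K in atTop,
      (3 / 4) ^ n ≤ |gapInt n (gridValues N ω t) K|) ∧ n < N := by
    refine (Finset.eventually_all s).2 fun n hn => ?_
    obtain ⟨hnn, u, hu, hu'⟩ := hs hn
    refine (eventually_le_abs_gapInt (hu.trans ht) (fun v hv => ⟨?_, ?_⟩) hu').and
      (eventually_gt_atTop n)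
    · exact (hn₁ n hnn).1.le.trans (hbt v hv)
    · have h1 := (le_abs_self _).trans (hB v ⟨by simp, hv⟩)
      linarith [(hn₁ n hnn).2]
  filter_upwards [hall] with N hN
  filter_upwards [(Finset.eventually_all s).2 fun n hn => (hN n hn).1] with K hK
  have h1 : (m : ℝ) ≤ ∑ n ∈ Finset.range N, (gapInt n (gridValues N ω t) K / (3 / 4) ^ n) ^ 2 := by
    calc (m : ℝ) = ∑ n ∈ s, (1 : ℝ) := by simp [hcard]
      _ ≤ ∑ n ∈ s, (gapInt n (gridValues N ω t) K / (3 / 4) ^ n) ^ 2 := by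
        refine Finset.sum_le_sum fun n hn => ?_
        have hp : (0 : ℝ) < (3 / 4) ^ n := by positivity
        rw [← sq_abs, abs_div, abs_of_pos hp]
        exact one_le_pow₀ ((one_le_div₀ hp).2 (hK n hn))
      _ ≤ _ := Finset.sum_le_sum_of_subset_of_nonneg
        (fun n hn => Finset.mem_range.2 (hN n hn).2) fun _ _ _ => sq_nonneg _
  have h2 : R ≤ c * m := by
    rw [div_le_iff₀ hc] at hm
    linarith
  exact h2.trans (by gcongr)

/-- The limiting value of the logarithm of the capital, with the optimal leverage `1 ± r / T`. -/
theorem log_two_div_le {δ T A : ℝ} (hT : 0 < T) {σ : ℝ}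
    (hσ : √(2 * T * Real.log (2 / δ)) ≤ σ * (A - T / 2)) (hσ2 : σ ^ 2 = 1) :
    Real.log (2 / δ) ≤ (1 + σ * (√(2 * T * Real.log (2 / δ)) / T) - 1) * A +
      ((1 + σ * (√(2 * T * Real.log (2 / δ)) / T)) -
        (1 + σ * (√(2 * T * Real.log (2 / δ)) / T)) ^ 2) / 2 * T := by
  set r := √(2 * T * Real.log (2 / δ)) with hr
  have hr0 : 0 ≤ r := Real.sqrt_nonneg _
  -- For `δ > 2` the square root is `0` and the inequality holds because the logarithm is negative.
  have h1 : 2 * T * Real.log (2 / δ) ≤ r ^ 2 := by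
    rcases le_total 0 (2 * T * Real.log (2 / δ)) with h | h
    · rw [hr, Real.sq_sqrt h]
    · exact h.trans (sq_nonneg r)
  have e : (1 + σ * (r / T) - 1) * A + ((1 + σ * (r / T)) - (1 + σ * (r / T)) ^ 2) / 2 * T =
      r / T * (σ * (A - T / 2)) - σ ^ 2 * r ^ 2 / (2 * T) := by
    field_simp
    ring
  rw [e, hσ2, one_mul]
  have h2 : r / T * r ≤ r / T * (σ * (A - T / 2)) := by gcongr
  have h3 : Real.log (2 / δ) ≤ r ^ 2 / (2 * T) := by
    rw [le_div_iff₀ (by positivity)]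
    linarith
  have h4 : r / T * r - r ^ 2 / (2 * T) = r ^ 2 / (2 * T) := by
    field_simp
    ring
  linarith

/-- Outside the event `logEvent`, the capital of the combined strategy is eventually close to the
price of `I` or greater. -/
theorem eventually_le_capital {δ T ε : ℝ} (hδ : 0 < δ) (hT : 0 < T) (hε : 0 < ε) {ω : PricePath}
    (hω : ω ∉ logEvent T (√(2 * T * Real.log (2 / δ)))) {ε' : ℝ} (hε' : 0 < ε') :
    ∃ t₀, ∀ t ≥ t₀, ∀ᶠ m : ℕ in atTop, ∀ᶠ N in atTop,
      FineFor (1 + √(2 * T * Real.log (2 / δ)) / T) N →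
      FineFor (1 - √(2 * T * Real.log (2 / δ)) / T) N → ∀ᶠ K in atTop,
        Real.exp (-ε') * ω.I t ≤ δ + ε + gain (totalRule δ ε (√(2 * T * Real.log (2 / δ)) / T)
          (T - 1 / ((m : ℝ) + 1)) N) (gridValues N ω t) K := by
  set θ := √(2 * T * Real.log (2 / δ)) / T with hθ
  have hc : 0 < ε / (gapCost + 1) := by
    have := gapCost_nonneg
    positivity
  by_cases hex : LimitsExist ω
  · have hω' : hitTime T ω < ∞ ∧ √(2 * T * Real.log (2 / δ)) ≤
        |Real.log (ω.I (hitTime T ω).toNNReal) - T / 2| := by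
      by_contra h
      refine hω ⟨hex, fun hfin => ?_⟩
      by_contra! hge
      exact h ⟨hfin, hge⟩
    obtain ⟨hfin, hge⟩ := hω'
    obtain ⟨hτ, hlt⟩ := hex.hitTime_spec hT hfin
    set τ := (hitTime T ω).toNNReal
    refine ⟨τ, fun t ht => ?_⟩
    obtain ⟨σ, hσ, hσge⟩ : ∃ σ : ℝ, (σ = 1 ∨ σ = -1) ∧
        √(2 * T * Real.log (2 / δ)) ≤ σ * (Real.log (ω.I τ) - T / 2) := by
      rcases le_abs.1 hge with h | h
      · exact ⟨1, .inl rfl, by linarith⟩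
      · exact ⟨-1, .inr rfl, by linarith⟩
    have hlog := log_two_div_le hT hσge (by rcases hσ with rfl | rfl <;> norm_num)
    rw [← hθ] at hlog
    obtain ⟨η₀, hη₀, H⟩ := eventually_le_portfolio hex hT hτ hlt ht (1 + σ * θ) hε'
    filter_upwards [(tendsto_one_div_add_atTop_nhds_zero_nat (𝕜 := ℝ)).eventually
      (gt_mem_nhds hη₀)] with m hm
    filter_upwards [H _ Nat.one_div_pos_of_nat hm] with N hN hf1 hf2
    have hy := isGridPath_gridValues N ω t
    have hfσ : FineFor (1 + σ * θ) N := by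
      rcases hσ with rfl | rfl
      · rwa [one_mul]
      · rwa [neg_one_mul, ← sub_eq_add_neg]
    filter_upwards [hN hfσ.1 hfσ.2, eventually_gridValues N ω t] with K hK hKt
    refine le_trans ?_ (le_totalRule_capital hε hy K)
    have hp1 := portfolio_pos hy hf1.1 hf1.2 (T - 1 / ((m : ℝ) + 1)) K
    have hp2 := portfolio_pos hy hf2.1 hf2.2 (T - 1 / ((m : ℝ) + 1)) K
    have hsum : portfolio (1 + σ * θ) (1 / ((N : ℝ) + 1)) (T - 1 / ((m : ℝ) + 1))
        (gridValues N ω t) K ≤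
        portfolio (1 + θ) (1 / ((N : ℝ) + 1)) (T - 1 / ((m : ℝ) + 1)) (gridValues N ω t) K +
        portfolio (1 - θ) (1 / ((N : ℝ) + 1)) (T - 1 / ((m : ℝ) + 1)) (gridValues N ω t) K := by
      rcases hσ with rfl | rfl
      · rw [one_mul]
        linarith
      · rw [neg_one_mul, ← sub_eq_add_neg]
        linarith
    have hexp : 2 / δ * Real.exp (-ε') ≤ portfolio (1 + σ * θ) (1 / ((N : ℝ) + 1))
        (T - 1 / ((m : ℝ) + 1)) (gridValues N ω t) K := by
      refine le_trans ?_ hK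
      rw [← Real.exp_log (show 0 < 2 / δ by positivity), ← Real.exp_add]
      exact Real.exp_le_exp.2 (by linarith)
    have hgap : 0 ≤ ε / (gapCost + 1) * (∑ n ∈ Finset.range N,
        (gapInt n (gridValues N ω t) K / (3 / 4) ^ n) ^ 2) :=
      mul_nonneg hc.le (Finset.sum_nonneg fun _ _ => sq_nonneg _)
    rw [hKt, ← add_mul]
    have hI := ω.pos_I t
    calc Real.exp (-ε') * ω.I t = δ / 2 * ((2 / δ * Real.exp (-ε')) * ω.I t) := by field_simp
      _ ≤ δ / 2 * ((portfolio (1 + θ) (1 / ((N : ℝ) + 1)) (T - 1 / ((m : ℝ) + 1))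
          (gridValues N ω t) K + portfolio (1 - θ) (1 / ((N : ℝ) + 1)) (T - 1 / ((m : ℝ) + 1))
          (gridValues N ω t) K) * ω.I t) := by
        gcongr
        exact hexp.trans hsum
      _ ≤ _ := le_add_of_nonneg_left hgap
  · obtain ⟨t₀, H⟩ := eventually_le_capital_of_not_limitsExist hex
    refine ⟨t₀, fun t ht => Eventually.of_forall fun m => ?_⟩
    filter_upwards [H t ht _ (Real.exp (-ε') * ω.I t) hc] with N hN hf1 hf2
    have hy := isGridPath_gridValues N ω t
    filter_upwards [hN] with K hK
    refine le_trans (hK.trans ?_) (le_totalRule_capital hε hy K)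
    have hp1 := portfolio_pos hy hf1.1 hf1.2 (T - 1 / ((m : ℝ) + 1)) K
    have hp2 := portfolio_pos hy hf2.1 hf2.2 (T - 1 / ((m : ℝ) + 1)) K
    have hyK := hy.pos K
    exact le_add_of_nonneg_right (by positivity)

/-! ### The upper probability -/

/-- The test supermartingale is an iterated `liminf` of the capitals of the combined strategies. -/
theorem upperProbI_compl_logEvent_le_add {δ T ε : ℝ} (hδ : 0 < δ) (hT : 0 < T) (hε : 0 < ε) :
    upperProbI (logEvent T (√(2 * T * Real.log (2 / δ))))ᶜ ≤ ((δ + ε : ℝ) : EReal) := by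
  set r := √(2 * T * Real.log (2 / δ)) with hr
  obtain ⟨N₀, hN₀⟩ := eventually_atTop.1
    ((eventually_fineFor (1 + r / T)).and (eventually_fineFor (1 - r / T)))
  have hF : ∀ q N, IsTradingRule (N + N₀) (totalRule δ ε (r / T) q (N + N₀)) := fun q N =>
    isTradingRule_totalRule (hN₀ _ (by omega)).1 (hN₀ _ (by omega)).2
  have hnn : ∀ q N y, IsGridPath (N + N₀) y → ∀ K,
      0 ≤ δ + ε + gain (totalRule δ ε (r / T) q (N + N₀)) y K := by
    intro q N y hy K
    refine le_trans ?_ (le_totalRule_capital hε hy K)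
    obtain ⟨hf1, hf2⟩ := hN₀ (N + N₀) (by omega)
    have hp1 := portfolio_pos hy hf1.1 hf1.2 q K
    have hp2 := portfolio_pos hy hf2.1 hf2.2 q K
    have hyK := hy.pos K
    have hS := gapCost_nonneg
    exact add_nonneg (mul_nonneg (by positivity) (Finset.sum_nonneg fun _ _ => sq_nonneg _))
      (by positivity)
  -- The margin `1 / (m + 1)` is removed only after the passage to the limit in the grid.
  set X : ℕ → ℕ → ℝ≥0 → PricePath → EReal := fun m N t ω =>
    (simpleCapital (ruleStrategy (hF (T - 1 / ((m : ℝ) + 1)) N)) (δ + ε) t ω : EReal) with hX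
  have hXT : ∀ m N, IsTestSupermartingale (X m N) := fun m N =>
    isTestSupermartingale_rule _ (hnn _ N)
  have hX0 : ∀ m N t ω, 0 ≤ X m N t ω := by
    intro m N t ω
    obtain ⟨K, hK⟩ := (simpleCapital_ruleStrategy (hF (T - 1 / ((m : ℝ) + 1)) N) (δ + ε) t ω).exists
    simp only [hX, hK]
    exact EReal.coe_nonneg.2 (hnn _ N _ (isGridPath_gridValues _ ω t) K)
  refine sInf_le ⟨fun t ω => liminf (fun m => liminf (fun N => X m N t ω) atTop) atTop,
    .liminf _ fun m => .liminf _ (hXT m), fun ω => ?_, fun ω => ?_⟩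
  · simp only [hX, simpleCapital_zero, liminf_const]
  by_cases hω : ω ∈ logEvent T r
  · rw [indicator_of_notMem (by simpa using hω)]
    refine le_liminf_of_le (by isBoundedDefault) (Eventually.of_forall fun t => ?_)
    refine EReal.div_nonneg ?_ (EReal.coe_nonneg.2 (ω.pos_I t).le)
    exact le_liminf_of_le (by isBoundedDefault) (Eventually.of_forall fun m =>
      le_liminf_of_le (by isBoundedDefault) (Eventually.of_forall fun N => hX0 m N t ω))
  · rw [indicator_of_mem (by simpa using hω)]
    have hlim : Tendsto (fun n : ℕ => ((Real.exp (-(1 / ((n : ℝ) + 1))) : ℝ) : EReal)) atTop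
        (𝓝 1) := by
      have h1 := (tendsto_one_div_add_atTop_nhds_zero_nat (𝕜 := ℝ)).neg
      have h2 := (Real.continuous_exp.tendsto _).comp h1
      rw [neg_zero, Real.exp_zero] at h2
      rw [← EReal.coe_one]
      exact (continuous_coe_real_ereal.tendsto (1 : ℝ)).comp h2
    refine le_of_tendsto' hlim fun n => ?_
    obtain ⟨t₀, ht₀⟩ := eventually_le_capital hδ hT hε hω (ε' := 1 / ((n : ℝ) + 1))
      Nat.one_div_pos_of_nat
    refine le_liminf_of_le (by isBoundedDefault) ?_
    filter_upwards [eventually_ge_atTop t₀] with t ht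
    rw [EReal.le_div_iff_mul_le (EReal.coe_pos.2 (ω.pos_I t)) (EReal.coe_ne_top _),
      ← EReal.coe_mul]
    refine le_liminf_of_le (by isBoundedDefault) ?_
    filter_upwards [ht₀ t ht] with m hm
    refine le_liminf_of_le (by isBoundedDefault) ?_
    filter_upwards [(tendsto_add_atTop_nat N₀).eventually hm] with N hN
    obtain ⟨hf1, hf2⟩ := hN₀ (N + N₀) (by omega)
    obtain ⟨K, hK1, hK2⟩ := ((hN hf1 hf2).and
      (simpleCapital_ruleStrategy (hF (T - 1 / ((m : ℝ) + 1)) N) (δ + ε) t ω)).exists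
    simp only [hX, hK2]
    exact EReal.coe_le_coe_iff.2 hK1

theorem one_sub_le_lowerProbI_logEvent {δ T : ℝ} (hδ : 0 < δ) (hT : 0 < T) :
    ((1 - δ : ℝ) : EReal) ≤ lowerProbI (logEvent T (√(2 * T * Real.log (2 / δ)))) := by
  have hlim : Tendsto (fun n : ℕ => ((δ + 1 / ((n : ℝ) + 1) : ℝ) : EReal)) atTop
      (𝓝 (δ : EReal)) := by
    have h1 := (tendsto_one_div_add_atTop_nhds_zero_nat (𝕜 := ℝ)).const_add δ
    rw [add_zero] at h1
    exact (continuous_coe_real_ereal.tendsto δ).comp h1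
  have h := ge_of_tendsto' hlim fun n =>
    upperProbI_compl_logEvent_le_add hδ hT (ε := 1 / ((n : ℝ) + 1)) Nat.one_div_pos_of_nat
  rw [lowerProbI, EReal.coe_sub, EReal.coe_one]
  exact EReal.sub_le_sub le_rfl h

end EquityPremium

theorem mainTheorem6 (δ T : ℝ) (hδ : 0 < δ) (hT : 0 < T) :
    ((1 - δ : ℝ) : EReal) ≤
        EquityPremium.lowerProbI
          (EquityPremium.growthEvent T (Real.sqrt (2 * T * Real.log (2 / δ)))) ∧
      ((1 - δ : ℝ) : EReal) ≤
        EquityPremium.lowerProbI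
          (EquityPremium.logEvent T (Real.sqrt (2 * T * Real.log (2 / δ)))) ∧
      EquityPremium.growthEvent T (Real.sqrt (2 * T * Real.log (2 / δ))) =
        EquityPremium.logEvent T (Real.sqrt (2 * T * Real.log (2 / δ))) := by
  rw [EquityPremium.growthEvent_eq_logEvent hT]
  exact ⟨EquityPremium.one_sub_le_lowerProbI_logEvent hδ hT,
    EquityPremium.one_sub_le_lowerProbI_logEvent hδ hT, rfl⟩
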